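/- Let $d\ge 1$ be an integer, let $p \in \bigl(2-\frac{2}{3d+2},\,2+\frac{2}{d}\bigr)$, and set $$q := p\,\frac{4d+2}{d(p+2)}, \qquad r := p\,\frac{4d+2}{p(3d+2)-2d}.$$ There is a constant $C=C(p,d)>0$ such that the following holds for every $T>0$. Write $\Omega_T := (-\infty,T)\times\mathbb R^{2d}$, with points $(t,x,v)$, $x,v\in\mathbb R^d$. Let $f \in L^2(\Omega_T)$ with $f\ge 0$ almost everywhere, let the weak gradient satisfy $\nabla_v f \in L^p(\Omega_T;\mathbb R^d)$, let $S_0 \in L^{\frac{p}{p-1}}(\Omega_T;\mathbb R^d)$ and $S_1\in L^r(\Omega_T)$, and suppose that $f$ is a weak subsolution of $$(\partial_t + v\cdot\nabla_x) f \le \nabla_v\cdot S_0 + S_1 \quad\text{in } \Omega_T,$$ that is, for every $\varphi\in C_c^\infty(\Omega_T)$ with $\varphi\ge 0$, $$\int_{\Omega_T} \bigl(-f\,(\partial_t+v\cdot\nabla_x)\varphi + S_0\cdot\nabla_v\varphi - S_1\varphi\bigr)\,\mathrm d(t,x,v) \le 0 .$$ Then $f\in L^q(\Omega_T)$ and $$\|f\|_{L^q(\Omega_T)}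 \le C\bigl(\|\nabla_v f\|_{L^p(\Omega_T)} + \|S_0\|_{L^{\frac{p}{p-1}}(\Omega_T)} + \|S_1\|_{L^r(\Omega_T)}\bigr).$$ -/

import Mathlib

open MeasureTheory Set
open scoped ContDiff

/-- The velocity (and position) space `ℝ^d` with its Euclidean norm. -/
abbrev Vel (d : ℕ) : Type := EuclideanSpace ℝ (Fin d)

/-- The phase space `ℝ^{1+2d}` of points `z = (t, x, v)`, with Lebesgue measure `volume`. -/
abbrev Phase (d : ℕ) : Type := ℝ × Vel d × Vel d

/-- The half-space `(-∞, T) × ℝ^{2d}`. -/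
def halfSpace (d : ℕ) (T : ℝ) : Set (Phase d) := {z | z.1 < T}

/-- Lebesgue measure on the half-space `(-∞, T) × ℝ^{2d}`. -/
noncomputable def halfMeasure (d : ℕ) (T : ℝ) : Measure (Phase d) :=
  (volume : Measure (Phase d)).restrict (halfSpace d T)

/-- Test functions: `φ ∈ C_c^∞(Ω)`, extended by zero to the whole phase space. -/
structure IsTestFunction {d : ℕ} (Ω : Set (Phase d)) (φ : Phase d → ℝ) : Prop where
  smooth : ContDiff ℝ ∞ φ
  compact : HasCompactSupport φ
  support : tsupport φ ⊆ Ω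

/-- The kinetic transport derivative `((∂_t + v · ∇_x) φ)(t, x, v)`. -/
noncomputable def transport {d : ℕ} (φ : Phase d → ℝ) (z : Phase d) : ℝ :=
  fderiv ℝ φ z (1, z.2.2, 0)

/-- The velocity derivative `∇_v φ(z) · e` of `φ` in the direction `e ∈ ℝ^d`. -/
noncomputable def velDeriv {d : ℕ} (φ : Phase d → ℝ) (z : Phase d) (e : Vel d) : ℝ :=
  fderiv ℝ φ z (0, 0, e)

/-- `G` is the weak velocity gradient `∇_v f` of `f` on `(-∞, T) × ℝ^{2d}`:
`∫ f (∇_v φ · e) = - ∫ (G · e) φ` for all test functions `φ` and all directions `e`. -/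
def IsWeakVelGrad {d : ℕ} (T : ℝ) (f : Phase d → ℝ) (G : Phase d → Vel d) : Prop :=
  ∀ φ : Phase d → ℝ, IsTestFunction (halfSpace d T) φ → ∀ e : Vel d,
    ∫ z, f z * velDeriv φ z e ∂(halfMeasure d T)
      = - ∫ z, inner ℝ (G z) e * φ z ∂(halfMeasure d T)

/-- `(∂_t + v · ∇_x) f ≤ ∇_v · S₀ + S₁` weakly in `(-∞, T) × ℝ^{2d}`:
`∫ (- f (∂_t + v · ∇_x) φ + S₀ · ∇_v φ - S₁ φ) ≤ 0` for all nonnegative test functions `φ`. -/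
def IsWeakSubsolution {d : ℕ} (T : ℝ) (f : Phase d → ℝ) (S₀ : Phase d → Vel d)
    (S₁ : Phase d → ℝ) : Prop :=
  ∀ φ : Phase d → ℝ, IsTestFunction (halfSpace d T) φ → (∀ z, 0 ≤ φ z) →
    ∫ z, (- (f z * transport φ z) + velDeriv φ z (S₀ z) - S₁ z * φ z) ∂(halfMeasure d T) ≤ 0

open scoped ENNReal Topology
open Filter

/-! The value f(z₀) is controlled by averaging the inequality over curves that run backwards in time
from z₀. Only the velocity of such a curve can be steered; its position follows. In Galilean
coordinates (τ, y, w) relative to z₀ the steering is chosen so that the pair X = τ^(-(1+β)) y, W =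
τ^(-β) w + (1+β) X rotates in the variable log τ. Hence |X|² + |W|² is conserved, the curves of
energy at most 1 stay in a cone |y| ≲ τ^(1+β), |w| ≲ τ^β that shrinks to z₀, and they transport a
density ρ of constant mass on time slices: with acceleration u, ∂_τ ρ - w·∇_y ρ + div_w(ρ u) = 0
(`fderiv_density_transport`).

Testing the subsolution with χ(τ) ρ and moving div_w(ρ u) onto the weak gradient
(`integral_deriv_cutoff_le`) bounds ∫ f χ' ρ by integrals of ∇_v f, S₀, S₁ against ρ u, ∇_w ρ, ρ. On
the cone these have sizes τ^(-(N+1-β)), τ^(-(N+β)), τ^(-N), where N = d(1+2β). Let χ rise from 0 to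
1 at lag ε and fall back at lag R. The far end disappears as R → ∞ because f is in L², and ε → 0
recovers f(z₀) up to a fixed factor. This gives the pointwise bound
`exists_enorm_le_kineticPotential`; since f ≥ 0, the one-sided inequality controls |f|. All lags are
positive, so everything stays in the half-space and no constant depends on T.

The cone has homogeneous dimension M = 1 + N, and a Hardy–Littlewood–Sobolev inequality
(`exists_kineticKernel_bound`, resting on `lintegral_kernel_rpow_le`) maps L^a to L^q for the kernel
τ^(-m) when M - m = M(1/a - 1/q). For the three kernels M - m equals β, 1 - β and 1. With a = p and
a = p/(p-1) the first two conditions determine β and q, and the third determines r. The assumed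
range of p is exactly 0 < β < 1. -/

/-! ### Power integrals and the layer-cake formula -/

theorem lintegral_rpow_Ioo {a c : ℝ} (ha : 0 < a) (hc : 0 < c) :
    ∫⁻ s in Ioo (0 : ℝ) c, ENNReal.ofReal (s ^ (a - 1)) = ENNReal.ofReal (c ^ a / a) := by
  have hint : IntervalIntegrable (fun s : ℝ => s ^ (a - 1)) volume 0 c :=
    intervalIntegral.intervalIntegrable_rpow' (by linarith)
  rw [intervalIntegrable_iff_integrableOn_Ioo_of_le hc.le] at hint
  rw [← ofReal_integral_eq_lintegral_ofReal hint]
  · rw [← integral_Ioc_eq_integral_Ioo, ← intervalIntegral.integral_of_le hc.le,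
      integral_rpow (Or.inl (by linarith))]
    simp [Real.zero_rpow ha.ne']
  · filter_upwards [ae_restrict_mem measurableSet_Ioo] with s hs
    exact Real.rpow_nonneg hs.1.le _

/-- Layer-cake identity for a single extended nonnegative number. -/
theorem lintegral_Ioi_rpow_of_lt {b : ℝ} (hb : 0 < b) (t : ℝ≥0∞) :
    ∫⁻ s in Ioi (0 : ℝ), {s : ℝ | ENNReal.ofReal s < t}.indicator
      (fun s => ENNReal.ofReal (s ^ (b - 1))) s = t ^ b / ENNReal.ofReal b := by
  have key : ∀ a : ℝ, 0 < a → ∫⁻ s in Ioo (0 : ℝ) a, ENNReal.ofReal (s ^ (b - 1))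
      = ENNReal.ofReal (a ^ b / b) := fun a ha => lintegral_rpow_Ioo hb ha
  have hm : MeasurableSet {s : ℝ | ENNReal.ofReal s < t} :=
    measurableSet_lt ENNReal.measurable_ofReal measurable_const
  rw [lintegral_indicator hm, Measure.restrict_restrict hm]
  rcases eq_or_ne t ⊤ with rfl | ht
  · rw [ENNReal.top_rpow_of_pos hb, ENNReal.top_div_of_ne_top ENNReal.ofReal_ne_top]
    have hs : {s : ℝ | ENNReal.ofReal s < ⊤} ∩ Ioi 0 = Ioi 0 := by ext; simp
    rw [hs]
    refine ENNReal.eq_top_of_forall_nnreal_le fun r => ?_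
    -- Chosen so that a ^ b / b = r + 1, which exceeds the arbitrary bound r; the 1 keeps a positive
    -- when r = 0.
    set a : ℝ := (b * (r + 1)) ^ b⁻¹ with hadef
    have hpos : 0 < b * ((r : ℝ) + 1) := by positivity
    have ha : 0 < a := Real.rpow_pos_of_pos hpos _
    calc (r : ℝ≥0∞) ≤ ENNReal.ofReal (a ^ b / b) := by
          rw [hadef, ← Real.rpow_mul hpos.le, inv_mul_cancel₀ hb.ne', Real.rpow_one,
            mul_div_cancel_left₀ _ hb.ne', ← NNReal.coe_one, ← NNReal.coe_add, ENNReal.ofReal_coe_nnreal]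
          exact_mod_cast le_self_add
      _ = _ := (key a ha).symm
      _ ≤ _ := lintegral_mono_set Ioo_subset_Ioi_self
  · lift t to NNReal using ht
    have hs : {s : ℝ | ENNReal.ofReal s < t} ∩ Ioi 0 = Ioo 0 (t : ℝ) := by
      ext s
      simp only [mem_inter_iff, mem_ofPred_eq, mem_Ioi, mem_Ioo]
      constructor
      · rintro ⟨h, h0⟩
        refine ⟨h0, ?_⟩
        rwa [← ENNReal.ofReal_coe_nnreal, ENNReal.ofReal_lt_ofReal_iff_of_nonneg h0.le] at h
      · rintro ⟨h0, h⟩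
        refine ⟨?_, h0⟩
        rwa [← ENNReal.ofReal_coe_nnreal, ENNReal.ofReal_lt_ofReal_iff_of_nonneg h0.le]
    rw [hs]
    rcases eq_or_ne t 0 with rfl | h0
    · simp [hb]
    · have hpos : (0 : ℝ) < t := by positivity
      rw [key _ hpos, ENNReal.ofReal_div_of_pos hb, ← ENNReal.ofReal_rpow_of_pos hpos,
        ENNReal.ofReal_coe_nnreal]

/-! ### An abstract Hardy–Littlewood–Sobolev inequality -/

section HardyLittlewoodSobolev

variable {X Y : Type*} [MeasurableSpace X] [MeasurableSpace Y] {μ : Measure X} {ν : Measure Y}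
  [SFinite μ] [SFinite ν]

/-- An integral operator whose kernel has, at every height `l`, a near part bounded in both
variables in `L¹` by `A l ^ (1 - q / p)` and a far part bounded in the dual exponent by `A l`,
maps the unit ball of `L^p` to a bounded set of `L^q`. -/
theorem lintegral_kernel_rpow_le {p q A : ℝ} (hp : 1 < p) (hpq : p < q) (hA : 0 ≤ A)
    {k : X × Y → ℝ≥0∞} (hk : Measurable k) {S : ℝ → Set (X × Y)}
    (hS : ∀ l, 0 < l → MeasurableSet (S l))
    (h1 : ∀ l, 0 < l → ∀ x, ∫⁻ y, (S l).indicator k (x, y) ∂ν ≤ ENNReal.ofReal (A * l ^ (1 - q / p)))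
    (h2 : ∀ l, 0 < l → ∀ y, ∫⁻ x, (S l).indicator k (x, y) ∂μ ≤ ENNReal.ofReal (A * l ^ (1 - q / p)))
    (h3 : ∀ l, 0 < l → ∀ x, (∫⁻ y, (S l)ᶜ.indicator k (x, y) ^ (p / (p - 1)) ∂ν) ^ (1 / (p / (p - 1)))
      ≤ ENNReal.ofReal (A * l))
    {g : Y → ℝ≥0∞} (hg : Measurable g) (hg1 : ∫⁻ y, g y ^ p ∂ν ≤ 1) :
    ∫⁻ x, (∫⁻ y, k (x, y) * g y ∂ν) ^ q ∂μ
      ≤ ENNReal.ofReal ((2 * A + 1) ^ q * (q * A / (q - q / p))) := by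
  have hp0 : 0 < p := by linarith
  have hq0 : 0 < q := by linarith
  have hqp : 0 < q - q / p := by
    have : q / p < q := div_lt_self hq0 hp
    linarith
  -- At height l the far kernel contributes at most A l, the near kernel on the low part of g at
  -- most A l, and the remaining piece is to be compared with l.
  set B : ℝ := 2 * A + 1 with hB
  have hB0 : 0 < B := by positivity
  have hBe : ENNReal.ofReal B ≠ 0 := by simpa using hB0
  -- the part of `g` above the threshold
  set gh : ℝ → Y → ℝ≥0∞ := fun l => {y | ENNReal.ofReal l < g y ^ (p / q)}.indicator g with hgh
  have hghm : Measurable (fun z : ℝ × Y => gh z.1 z.2) := by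
    have : MeasurableSet {z : ℝ × Y | ENNReal.ofReal z.1 < g z.2 ^ (p / q)} :=
      measurableSet_lt (by fun_prop) (by fun_prop)
    exact (hg.comp measurable_snd).indicator this
  have hghl : ∀ l, Measurable (gh l) := fun l => hghm.comp measurable_prodMk_left
  have hkx : ∀ x, Measurable fun y => k (x, y) := fun x => hk.comp measurable_prodMk_left
  have hSk : ∀ l, 0 < l → Measurable ((S l).indicator k) := fun l hl => hk.indicator (hS l hl)
  have hSx : ∀ l, 0 < l → ∀ x, Measurable fun y => (S l).indicator k (x, y) :=
    fun l hl x => (hSk l hl).comp measurable_prodMk_left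
  have hSy : ∀ l, 0 < l → ∀ y, Measurable fun x => (S l).indicator k (x, y) :=
    fun l hl y => (hSk l hl).comp measurable_prodMk_right
  have hSk' : ∀ l, 0 < l → Measurable ((S l)ᶜ.indicator k) :=
    fun l hl => hk.indicator (hS l hl).compl
  set U : X → ℝ≥0∞ := fun x => (∫⁻ y, k (x, y) * g y ∂ν) / ENNReal.ofReal B with hU
  have hUm : Measurable U := by
    have : Measurable fun x => ∫⁻ y, k (x, y) * g y ∂ν :=
      Measurable.lintegral_prod_right' (f := fun z : X × Y => k z * g z.2) (by fun_prop)
    exact this.div_const _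
  -- The threshold l ^ (q / p) for g is the one at which the near kernel, of mass A l ^ (1 - q / p),
  -- sends the low part to at most A l. So wherever the operator exceeds B l, the near kernel acting
  -- on the high part of g must already reach l.
  have hlevel : ∀ l, 0 < l → ∀ x, ENNReal.ofReal l < U x →
      ENNReal.ofReal l ≤ ∫⁻ y, (S l).indicator k (x, y) * gh l y ∂ν := by
    intro l hl x hx
    by_contra! hcon
    have hbound : ∀ y, k (x, y) * g y ≤ (S l)ᶜ.indicator k (x, y) * g y
        + ((S l).indicator k (x, y) * ENNReal.ofReal (l ^ (q / p))
          + (S l).indicator k (x, y) * gh l y) := by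
      intro y
      by_cases hy : (x, y) ∈ S l
      · by_cases hgy : ENNReal.ofReal l < g y ^ (p / q)
        · simp [hy, hgh, hgy]
        · have : g y ≤ ENNReal.ofReal (l ^ (q / p)) := by
            rw [not_lt] at hgy
            rw [← ENNReal.ofReal_rpow_of_pos hl]
            calc g y = (g y ^ (p / q)) ^ (q / p) := by
                  rw [← ENNReal.rpow_mul]; field_simp; simp
              _ ≤ _ := ENNReal.rpow_le_rpow hgy (by positivity)
          simp only [hy, hgh, hgy, mem_compl_iff, not_true_eq_false, not_false_eq_true,
            indicator_of_notMem, indicator_of_mem, zero_mul, zero_add, mem_ofPred_eq, mul_zero,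
            add_zero]
          gcongr
      · simp [hy]
    have hfar : ∫⁻ y, (S l)ᶜ.indicator k (x, y) * g y ∂ν ≤ ENNReal.ofReal (A * l) := by
      have hc : (p / (p - 1)).HolderConjugate p :=
        ((Real.HolderConjugate.conjExponent hp)).symm
      refine (ENNReal.lintegral_mul_le_Lp_mul_Lq ν hc
        ((hSk' l hl).comp measurable_prodMk_left).aemeasurable hg.aemeasurable).trans ?_
      calc _ ≤ ENNReal.ofReal (A * l) * 1 := by
            gcongr
            · exact h3 l hl x
            · exact ENNReal.rpow_le_one hg1 (by positivity)
        _ = _ := mul_one _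
    have hlow : ∫⁻ y, (S l).indicator k (x, y) * ENNReal.ofReal (l ^ (q / p)) ∂ν
        ≤ ENNReal.ofReal (A * l) := by
      rw [lintegral_mul_const _ (hSx l hl x)]
      calc _ ≤ ENNReal.ofReal (A * l ^ (1 - q / p)) * ENNReal.ofReal (l ^ (q / p)) := by
            gcongr; exact h1 l hl x
        _ = _ := by
            rw [← ENNReal.ofReal_mul (by positivity), mul_assoc, ← Real.rpow_add hl]
            simp
    have : ∫⁻ y, k (x, y) * g y ∂ν ≤ ENNReal.ofReal (B * l) := by
      calc _ ≤ ∫⁻ y, ((S l)ᶜ.indicator k (x, y) * g y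
            + ((S l).indicator k (x, y) * ENNReal.ofReal (l ^ (q / p))
          + (S l).indicator k (x, y) * gh l y)) ∂ν := lintegral_mono hbound
        _ ≤ ENNReal.ofReal (A * l) + (ENNReal.ofReal (A * l) + ENNReal.ofReal l) := by
            rw [lintegral_add_left, lintegral_add_left]
            · gcongr
            · exact ((hSk l hl).comp measurable_prodMk_left).mul_const _
            · exact ((hSk' l hl).comp measurable_prodMk_left).mul hg
        _ = ENNReal.ofReal (B * l) := by
            rw [← ENNReal.ofReal_add (by positivity) hl.le,
              ← ENNReal.ofReal_add (by positivity) (by positivity)]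
            congr 1; rw [hB]; ring
    have h' : U x ≤ ENNReal.ofReal l := by
      rw [hU]
      refine ENNReal.div_le_of_le_mul ?_
      rwa [← ENNReal.ofReal_mul hl.le, mul_comm l]
    exact absurd hx (not_lt.mpr h')
  have hthird : ∀ l, 0 < l → ∫⁻ x, ∫⁻ y, (S l).indicator k (x, y) * gh l y ∂ν ∂μ
      ≤ ENNReal.ofReal (A * l ^ (1 - q / p)) * ∫⁻ y, gh l y ∂ν := by
    intro l hl
    rw [lintegral_lintegral_swap]
    · rw [← lintegral_const_mul _ (hghl l)]
      refine lintegral_mono fun y => ?_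
      rw [lintegral_mul_const _ (hSy l hl y)]
      gcongr
      exact h2 l hl y
    · exact ((hSk l hl).mul ((hghl l).comp measurable_snd)).aemeasurable
  -- Layer cake with Markov's inequality at each height, the truncation of g moving with the height;
  -- this gives the strong-type bound directly, without interpolation. After Fubini the height
  -- integral of l ^ (q - q / p - 1) up to g ^ (p / q) produces g ^ (p - 1), and the remaining
  -- factor g completes the p-th power.
  have hUq : ∫⁻ x, U x ^ q / ENNReal.ofReal q ∂μ
      ≤ ENNReal.ofReal A * ((∫⁻ y, g y ^ p ∂ν) / ENNReal.ofReal (q - q / p)) := by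
    have hUl : MeasurableSet {z : X × ℝ | ENNReal.ofReal z.2 < U z.1} :=
      measurableSet_lt (by fun_prop) (by fun_prop)
    calc ∫⁻ x, U x ^ q / ENNReal.ofReal q ∂μ
        = ∫⁻ x, (∫⁻ l in Ioi (0 : ℝ), {s : ℝ | ENNReal.ofReal s < U x}.indicator
            (fun s => ENNReal.ofReal (s ^ (q - 1))) l) ∂μ := by
          simp_rw [lintegral_Ioi_rpow_of_lt hq0]
      _ = ∫⁻ l in Ioi (0 : ℝ), ∫⁻ x, {s : ℝ | ENNReal.ofReal s < U x}.indicator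
            (fun s => ENNReal.ofReal (s ^ (q - 1))) l ∂μ := by
          rw [lintegral_lintegral_swap]
          refine Measurable.aemeasurable ?_
          exact Measurable.indicator (f := fun z : X × ℝ => ENNReal.ofReal (z.2 ^ (q - 1)))
            (by fun_prop) hUl
      _ ≤ ∫⁻ l in Ioi (0 : ℝ), ENNReal.ofReal A * ∫⁻ y, g y *
            {s : ℝ | ENNReal.ofReal s < g y ^ (p / q)}.indicator
              (fun s => ENNReal.ofReal (s ^ (q - q / p - 1))) l ∂ν := by
          refine setLIntegral_mono' measurableSet_Ioi fun l (hl : 0 < l) => ?_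
          calc ∫⁻ x, {s : ℝ | ENNReal.ofReal s < U x}.indicator
                (fun s => ENNReal.ofReal (s ^ (q - 1))) l ∂μ
              ≤ ∫⁻ x, ENNReal.ofReal (l ^ (q - 2)) *
                  ∫⁻ y, (S l).indicator k (x, y) * gh l y ∂ν ∂μ := by
                refine lintegral_mono fun x => ?_
                by_cases hx : ENNReal.ofReal l < U x
                · rw [indicator_of_mem (by exact hx)]
                  calc ENNReal.ofReal (l ^ (q - 1))
                      = ENNReal.ofReal (l ^ (q - 2)) * ENNReal.ofReal l := by
                        rw [← ENNReal.ofReal_mul (by positivity)]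
                        nth_rewrite 3 [← Real.rpow_one l]
                        rw [← Real.rpow_add hl]; congr 2; ring
                    _ ≤ _ := by gcongr; exact hlevel l hl x hx
                · rw [indicator_of_notMem (by exact hx)]; exact zero_le
            _ = ENNReal.ofReal (l ^ (q - 2)) *
                  ∫⁻ x, ∫⁻ y, (S l).indicator k (x, y) * gh l y ∂ν ∂μ := by
                rw [lintegral_const_mul]
                exact Measurable.lintegral_prod_right'
                  (f := fun z : X × Y => (S l).indicator k z * gh l z.2)
                  ((hSk l hl).mul ((hghl l).comp measurable_snd))
            _ ≤ ENNReal.ofReal (l ^ (q - 2)) *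
                  (ENNReal.ofReal (A * l ^ (1 - q / p)) * ∫⁻ y, gh l y ∂ν) := by
                gcongr; exact hthird l hl
            _ = ENNReal.ofReal A * (ENNReal.ofReal (l ^ (q - q / p - 1)) * ∫⁻ y, gh l y ∂ν) := by
                rw [← mul_assoc, ← mul_assoc, ← ENNReal.ofReal_mul (by positivity),
                  ← ENNReal.ofReal_mul hA]
                congr 2
                rw [show q - q / p - 1 = (q - 2) + (1 - q / p) by ring, Real.rpow_add hl]
                ring
            _ = _ := by
                congr 1
                rw [← lintegral_const_mul _ (hghl l)]
                refine lintegral_congr fun y => ?_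
                by_cases hy : ENNReal.ofReal l < g y ^ (p / q)
                · rw [indicator_of_mem (by exact hy)]
                  simp [hgh, hy, mul_comm]
                · rw [indicator_of_notMem (by exact hy)]
                  simp [hgh, hy]
      _ = ENNReal.ofReal A * ∫⁻ y, g y * (∫⁻ l in Ioi (0 : ℝ),
            {s : ℝ | ENNReal.ofReal s < g y ^ (p / q)}.indicator
              (fun s => ENNReal.ofReal (s ^ (q - q / p - 1))) l) ∂ν := by
          have hmeas : Measurable (fun z : ℝ × Y => g z.2 *
              {s : ℝ | ENNReal.ofReal s < g z.2 ^ (p / q)}.indicator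
              (fun s => ENNReal.ofReal (s ^ (q - q / p - 1))) z.1) := by
            refine (hg.comp measurable_snd).mul ?_
            exact Measurable.indicator (f := fun z : ℝ × Y => ENNReal.ofReal (z.1 ^ (q - q / p - 1)))
              (by fun_prop) (measurableSet_lt (by fun_prop) (by fun_prop))
          rw [lintegral_const_mul _ hmeas.lintegral_prod_right', lintegral_lintegral_swap
            hmeas.aemeasurable]
          congr 1
          refine lintegral_congr fun y => ?_
          exact lintegral_const_mul (g y) (Measurable.indicator (s := {s : ℝ | ENNReal.ofReal s < g y ^ (p / q)})
            (f := fun s : ℝ => ENNReal.ofReal (s ^ (q - q / p - 1))) (by fun_prop)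
            (measurableSet_lt ENNReal.measurable_ofReal measurable_const))
      _ = ENNReal.ofReal A * ((∫⁻ y, g y ^ p ∂ν) / ENNReal.ofReal (q - q / p)) := by
          congr 1
          rw [div_eq_mul_inv (∫⁻ y, g y ^ p ∂ν), ← lintegral_mul_const _ (hg.pow_const p)]
          refine lintegral_congr fun y => ?_
          rw [lintegral_Ioi_rpow_of_lt hqp (g y ^ (p / q)), ENNReal.div_eq_inv_mul, mul_left_comm,
            mul_comm _ (ENNReal.ofReal _)⁻¹]
          congr 1
          rw [← ENNReal.rpow_mul, show p / q * (q - q / p) = p - 1 by field_simp]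
          nth_rewrite 1 [← ENNReal.rpow_one (g y)]
          rw [← ENNReal.rpow_add_of_nonneg _ _ zero_le_one (by linarith)]
          congr 1; ring
  have hTU : ∀ x, (∫⁻ y, k (x, y) * g y ∂ν) ^ q
      = ENNReal.ofReal (B ^ q) * (ENNReal.ofReal q * (U x ^ q / ENNReal.ofReal q)) := by
    intro x
    have hqe : ENNReal.ofReal q ≠ 0 := by simpa using hq0
    rw [ENNReal.mul_div_cancel hqe ENNReal.ofReal_ne_top, ← ENNReal.ofReal_rpow_of_pos hB0,
      ← ENNReal.mul_rpow_of_nonneg _ _ hq0.le, hU,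
      ENNReal.mul_div_cancel hBe ENNReal.ofReal_ne_top]
  simp_rw [hTU]
  have hm1 : Measurable fun x => U x ^ q / ENNReal.ofReal q := by fun_prop
  rw [lintegral_const_mul _ (by fun_prop), lintegral_const_mul _ hm1,
    ENNReal.ofReal_mul (by positivity)]
  gcongr
  calc _ ≤ ENNReal.ofReal q * (ENNReal.ofReal A * (1 / ENNReal.ofReal (q - q / p))) := by
        gcongr; exact hUq.trans (by gcongr)
    _ = _ := by
        rw [ENNReal.ofReal_div_of_pos hqp, ENNReal.ofReal_mul hq0.le, one_div, ← div_eq_mul_inv,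
          mul_div_assoc]

/-- Hardy–Littlewood–Sobolev inequality for kernels with a near/far splitting. -/
theorem exists_lintegral_kernel_le {p q A : ℝ} (hp : 1 < p) (hpq : p < q) (hA : 0 ≤ A)
    {k : X × Y → ℝ≥0∞} (hk : Measurable k) {S : ℝ → Set (X × Y)}
    (hS : ∀ l, 0 < l → MeasurableSet (S l))
    (h1 : ∀ l, 0 < l → ∀ x, ∫⁻ y, (S l).indicator k (x, y) ∂ν ≤ ENNReal.ofReal (A * l ^ (1 - q / p)))
    (h2 : ∀ l, 0 < l → ∀ y, ∫⁻ x, (S l).indicator k (x, y) ∂μ ≤ ENNReal.ofReal (A * l ^ (1 - q / p)))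
    (h3 : ∀ l, 0 < l → ∀ x, (∫⁻ y, (S l)ᶜ.indicator k (x, y) ^ (p / (p - 1)) ∂ν) ^ (1 / (p / (p - 1)))
      ≤ ENNReal.ofReal (A * l))
    {g : Y → ℝ≥0∞} (hg : AEMeasurable g ν) :
    (∫⁻ x, (∫⁻ y, k (x, y) * g y ∂ν) ^ q ∂μ) ^ (1 / q)
      ≤ ENNReal.ofReal (((2 * A + 1) ^ q * (q * A / (q - q / p))) ^ (1 / q) + 1)
        * (∫⁻ y, g y ^ p ∂ν) ^ (1 / p) := by
  have hp0 : 0 < p := by linarith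
  have hq0 : 0 < q := by linarith
  have hqp : 0 < q - q / p := by
    have : q / p < q := div_lt_self hq0 hp
    linarith
  wlog hgm : Measurable g generalizing g
  · have hae := hg.ae_eq_mk
    have e1 : ∀ x, ∫⁻ y, k (x, y) * g y ∂ν = ∫⁻ y, k (x, y) * hg.mk g y ∂ν := fun x =>
      lintegral_congr_ae (by filter_upwards [hae] with y hy; rw [hy])
    have e2 : ∫⁻ y, g y ^ p ∂ν = ∫⁻ y, hg.mk g y ^ p ∂ν :=
      lintegral_congr_ae (by filter_upwards [hae] with y hy; rw [hy])
    simp_rw [e1, e2]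
    exact this hg.measurable_mk.aemeasurable hg.measurable_mk
  set C : ℝ := (2 * A + 1) ^ q * (q * A / (q - q / p)) with hC
  have hC0 : 0 ≤ C := by positivity
  set N : ℝ≥0∞ := (∫⁻ y, g y ^ p ∂ν) ^ (1 / p) with hN
  have hNp : N ^ p = ∫⁻ y, g y ^ p ∂ν := by
    rw [hN, ← ENNReal.rpow_mul, one_div, inv_mul_cancel₀ hp0.ne', ENNReal.rpow_one]
  have hkx : ∀ x, Measurable fun y => k (x, y) := fun x => hk.comp measurable_prodMk_left
  rcases eq_or_ne N ⊤ with hNt | hNt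
  -- The summand 1 in the constant keeps it nonzero even when A = 0, so the right-hand side is
  -- infinite here.
  · rw [hNt, ENNReal.mul_top (by simp; positivity)]
    exact le_top
  rcases eq_or_ne N 0 with hN0 | hN0
  · have : ∫⁻ y, g y ^ p ∂ν = 0 := by rw [← hNp, hN0, ENNReal.zero_rpow_of_pos hp0]
    rw [lintegral_eq_zero_iff (hgm.pow_const p)] at this
    have hz : ∀ x, ∫⁻ y, k (x, y) * g y ∂ν = 0 := by
      intro x
      have hm : Measurable fun y => k (x, y) * g y := (hkx x).mul hgm
      rw [lintegral_eq_zero_iff hm]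
      filter_upwards [this] with y hy
      have : g y = 0 := by simpa [hp0, hp0.le, not_lt.mpr hp0.le] using hy
      simp [this]
    simp [hz, hq0, hN0]
  have hnorm : ∫⁻ y, (g y / N) ^ p ∂ν ≤ 1 := by
    simp_rw [ENNReal.div_rpow_of_nonneg _ _ hp0.le, div_eq_mul_inv]
    rw [lintegral_mul_const _ (hgm.pow_const p), ← hNp, ENNReal.mul_inv_cancel]
    · simp [hN0, hp0, hNt]
    · simp [hNt, hp0, hN0]
  have main := lintegral_kernel_rpow_le hp hpq hA hk hS h1 h2 h3 (hgm.div_const N) hnorm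
  have hT : ∀ x, ∫⁻ y, k (x, y) * g y ∂ν = N * ∫⁻ y, k (x, y) * (g y / N) ∂ν := by
    intro x
    have hm : Measurable fun y => k (x, y) * (g y / N) := (hkx x).mul (hgm.div_const N)
    rw [← lintegral_const_mul _ hm]
    refine lintegral_congr fun y => ?_
    rw [mul_left_comm, ENNReal.mul_div_cancel hN0 hNt]
  have hmT : Measurable fun x => ∫⁻ y, k (x, y) * (g y / N) ∂ν :=
    Measurable.lintegral_prod_right' (f := fun z : X × Y => k z * (g z.2 / N)) (by fun_prop)
  simp_rw [hT, ENNReal.mul_rpow_of_nonneg _ _ hq0.le]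
  rw [lintegral_const_mul _ (hmT.pow_const q), ENNReal.mul_rpow_of_nonneg _ _ (by positivity),
    ← ENNReal.rpow_mul, mul_one_div_cancel hq0.ne', ENNReal.rpow_one, mul_comm]
  gcongr
  calc _ ≤ (ENNReal.ofReal C) ^ (1 / q) := ENNReal.rpow_le_rpow main (by positivity)
    _ = ENNReal.ofReal (C ^ (1 / q)) := ENNReal.ofReal_rpow_of_nonneg hC0 (by positivity)
    _ ≤ _ := ENNReal.ofReal_le_ofReal (by linarith)

end HardyLittlewoodSobolev

/-! ### Galilean coordinates, the kinetic cone and its kernels -/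

/-- Galilean coordinates `(τ, y, w)` of `z` relative to `z₀`, with time running backwards. -/
def relCoord {d : ℕ} (z₀ z : Phase d) : Phase d :=
  (z₀.1 - z.1, z.2.1 - z₀.2.1 + (z₀.1 - z.1) • z₀.2.2, z.2.2 - z₀.2.2)

/-- The kinetic cone `τ > 0`, `|y| ≤ L τ ^ (1 + β)`, `|w| ≤ L τ ^ β`. -/
def kineticCone (d : ℕ) (β L : ℝ) : Set (Phase d) :=
  {ζ | 0 < ζ.1 ∧ ‖ζ.2.1‖ ≤ L * ζ.1 ^ (1 + β) ∧ ‖ζ.2.2‖ ≤ L * ζ.1 ^ β}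

/-- The kernel `τ ^ (-m)` on the kinetic cone. -/
noncomputable def kineticKernel {d : ℕ} (β L m : ℝ) (z : Phase d × Phase d) : ℝ≥0∞ :=
  (kineticCone d β L).indicator (fun ζ => ENNReal.ofReal (ζ.1 ^ (-m))) (relCoord z.1 z.2)

theorem continuous_relCoord {d : ℕ} :
    Continuous fun z : Phase d × Phase d => relCoord z.1 z.2 := by
  unfold relCoord; fun_prop

theorem measurableSet_kineticCone (d : ℕ) (β L : ℝ) : MeasurableSet (kineticCone d β L) := by
  unfold kineticCone
  have h0 : MeasurableSet {ζ : Phase d | 0 < ζ.1} :=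
    measurableSet_lt (by fun_prop) (by fun_prop)
  have h1 : MeasurableSet {ζ : Phase d | ‖ζ.2.1‖ ≤ L * ζ.1 ^ (1 + β)} :=
    measurableSet_le (by fun_prop) (by fun_prop)
  have h2 : MeasurableSet {ζ : Phase d | ‖ζ.2.2‖ ≤ L * ζ.1 ^ β} :=
    measurableSet_le (by fun_prop) (by fun_prop)
  exact h0.inter (h1.inter h2)

theorem measurable_kineticKernel {d : ℕ} (β L m : ℝ) :
    Measurable (kineticKernel (d := d) β L m) := by
  have : Measurable ((kineticCone d β L).indicator (fun ζ => ENNReal.ofReal (ζ.1 ^ (-m)))) :=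
    Measurable.indicator (by fun_prop) (measurableSet_kineticCone d β L)
  exact this.comp continuous_relCoord.measurable

/-- The volume of the unit ball of the velocity space. -/
noncomputable def unitBallVolume (d : ℕ) : ℝ := (volume (Metric.closedBall (0 : Vel d) 1)).toReal

theorem ofReal_unitBallVolume (d : ℕ) :
    ENNReal.ofReal (unitBallVolume d) = volume (Metric.closedBall (0 : Vel d) 1) :=
  ENNReal.ofReal_toReal measure_closedBall_lt_top.ne

theorem volume_closedBall_eq {d : ℕ} (x : Vel d) {r : ℝ} (hr : 0 ≤ r) :
    volume (Metric.closedBall x r) = ENNReal.ofReal (r ^ d * unitBallVolume d) := by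
  rw [Measure.addHaar_closedBall' _ _ hr, ENNReal.ofReal_mul (by positivity),
    ofReal_unitBallVolume]
  simp

/-- Integrating a function supported on a tube of cells over phase space. -/
theorem lintegral_phase_le {d : ℕ} {F : Phase d → ℝ≥0∞} (hF : Measurable F) {h : ℝ → ℝ≥0∞}
    {a b : ℝ → ℝ} {c : ℝ → Vel d} {v₀ : Vel d}
    (hsupp : ∀ z, F z ≠ 0 → z.2.1 ∈ Metric.closedBall (c z.1) (a z.1) ∧
      z.2.2 ∈ Metric.closedBall v₀ (b z.1)) (hFh : ∀ z, F z ≤ h z.1) :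
    ∫⁻ z, F z ≤ ∫⁻ t, h t * (volume (Metric.closedBall (c t) (a t)) *
      volume (Metric.closedBall v₀ (b t))) := by
  have e1 : ∫⁻ z, F z = ∫⁻ t, ∫⁻ y : Vel d × Vel d, F (t, y) :=
    lintegral_prod _ hF.aemeasurable
  rw [e1]
  refine lintegral_mono fun t => ?_
  have hle : ∀ y : Vel d × Vel d, F (t, y) ≤
      (Metric.closedBall (c t) (a t) ×ˢ Metric.closedBall v₀ (b t)).indicator (fun _ => h t) y := by
    intro y
    by_cases hy : F (t, y) = 0
    · rw [hy]; exact zero_le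
    · rw [indicator_of_mem (show y ∈ _ from hsupp _ hy)]
      exact hFh (t, y)
  refine (lintegral_mono hle).trans ?_
  rw [lintegral_indicator_const (measurableSet_closedBall.prod measurableSet_closedBall)]
  rw [Measure.volume_eq_prod, Measure.prod_prod]

/-- The measure of a time slice of the kinetic cone, up to the dimensional constant. -/
theorem volume_slice_eq {d : ℕ} (x v : Vel d) {β L τ : ℝ} (hL : 0 ≤ L) (hτ : 0 < τ) :
    volume (Metric.closedBall x (L * τ ^ (1 + β))) * volume (Metric.closedBall v (L * τ ^ β))
      = ENNReal.ofReal ((L ^ d * unitBallVolume d) ^ 2) *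
        ENNReal.ofReal (τ ^ (d * (1 + 2 * β))) := by
  rw [volume_closedBall_eq _ (by positivity), volume_closedBall_eq _ (by positivity),
    ← ENNReal.ofReal_mul (by unfold unitBallVolume; positivity), ← ENNReal.ofReal_mul (by positivity)]
  congr 1
  rw [mul_pow, mul_pow, ← Real.rpow_natCast (τ ^ (1 + β)), ← Real.rpow_natCast (τ ^ β),
    ← Real.rpow_mul hτ.le, ← Real.rpow_mul hτ.le,
    show (d : ℝ) * (1 + 2 * β) = (1 + β) * d + β * d by ring, Real.rpow_add hτ]
  ring

theorem lintegral_rpow_Ici {a c : ℝ} (ha : 0 < a) (hc : 0 < c) :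
    ∫⁻ s in Ici c, ENNReal.ofReal (s ^ (-a - 1)) = ENNReal.ofReal (c ^ (-a) / a) := by
  have hint := integrableOn_Ioi_rpow_of_lt (show -a - 1 < -1 by linarith) hc
  rw [setLIntegral_congr Ioi_ae_eq_Ici.symm, ← ofReal_integral_eq_lintegral_ofReal hint]
  · rw [integral_Ioi_rpow_of_lt (by linarith) hc]
    congr 1
    rw [show -a - 1 + 1 = -a by ring]; field_simp
  · filter_upwards [ae_restrict_mem measurableSet_Ioi] with s hs
    exact Real.rpow_nonneg (hc.trans hs).le _

/-! ### Near and far bounds for the kinetic kernels -/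

section KernelBounds

variable {d : ℕ} {β L m : ℝ}

theorem kineticKernel_eq_zero {z₀ z : Phase d} (h : relCoord z₀ z ∉ kineticCone d β L) :
    kineticKernel β L m (z₀, z) = 0 := indicator_of_notMem h _

theorem kineticKernel_eq {z₀ z : Phase d} (h : relCoord z₀ z ∈ kineticCone d β L) :
    kineticKernel β L m (z₀, z) = ENNReal.ofReal ((z₀.1 - z.1) ^ (-m)) := indicator_of_mem h _

/-- Radius L would suffice with z₀ fixed. The factor 2 matches the case with z fixed, so that both
marginals reduce to the same slice integral. -/
theorem mem_ball_of_relCoord_mem (hL : 0 ≤ L) {z₀ z : Phase d}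
    (h : relCoord z₀ z ∈ kineticCone d β L) :
    z.2.1 ∈ Metric.closedBall (z₀.2.1 - (z₀.1 - z.1) • z₀.2.2)
        ((2 * L) * (z₀.1 - z.1) ^ (1 + β)) ∧
      z.2.2 ∈ Metric.closedBall z₀.2.2 ((2 * L) * (z₀.1 - z.1) ^ β) := by
  obtain ⟨h0, h1, h2⟩ := h
  simp only [relCoord] at h0 h1 h2
  have p1 : 0 ≤ L * (z₀.1 - z.1) ^ (1 + β) := by positivity
  have p2 : 0 ≤ L * (z₀.1 - z.1) ^ β := by positivity
  rw [mem_closedBall_iff_norm, mem_closedBall_iff_norm]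
  constructor
  · rw [← sub_add]; linarith
  · linarith

/-- Seen from z, the free motion uses the velocity of z instead of that of z₀. The discrepancy is τ
w, of size at most L τ ^ (1 + β), which is the same scale as the cone in position; hence the factor
2. -/
theorem mem_ball_of_relCoord_mem' (hL : 0 ≤ L) {z₀ z : Phase d}
    (h : relCoord z₀ z ∈ kineticCone d β L) :
    z₀.2.1 ∈ Metric.closedBall (z.2.1 + (z₀.1 - z.1) • z.2.2)
        ((2 * L) * (z₀.1 - z.1) ^ (1 + β)) ∧
      z₀.2.2 ∈ Metric.closedBall z.2.2 ((2 * L) * (z₀.1 - z.1) ^ β) := by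
  obtain ⟨h0, h1, h2⟩ := h
  simp only [relCoord] at h0 h1 h2
  have p2 : 0 ≤ L * (z₀.1 - z.1) ^ β := by positivity
  rw [mem_closedBall_iff_norm', mem_closedBall_iff_norm']
  constructor
  · have e : z.2.1 + (z₀.1 - z.1) • z.2.2 - z₀.2.1 = (z.2.1 - z₀.2.1 + (z₀.1 - z.1) • z₀.2.2)
        + (z₀.1 - z.1) • (z.2.2 - z₀.2.2) := by rw [smul_sub]; abel
    rw [e]
    refine (norm_add_le _ _).trans ?_
    rw [norm_smul, Real.norm_of_nonneg h0.le]
    have : (z₀.1 - z.1) * ‖z.2.2 - z₀.2.2‖ ≤ L * (z₀.1 - z.1) ^ (1 + β) := by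
      calc _ ≤ (z₀.1 - z.1) * (L * (z₀.1 - z.1) ^ β) := by gcongr
        _ = _ := by rw [Real.rpow_add h0, Real.rpow_one]; ring
    linarith
  · linarith

/-- The dimensional constant in the kernel bounds. -/
noncomputable def coneConst (d : ℕ) (L : ℝ) : ℝ := ((2 * L) ^ d * unitBallVolume d) ^ 2

/-- A slice of the cone has volume comparable to τ ^ (M - 1), with M = 1 + d (1 + 2β), so τ ^ (-m)
is integrable near τ = 0 precisely because m < M. -/
theorem lintegral_slice_near (hL : 0 ≤ L) (hm : m < 1 + d * (1 + 2 * β)) {c : ℝ} (hc : 0 < c)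
    (x : ℝ → Vel d) (v : Vel d) :
    ∫⁻ τ, (Ioo 0 c).indicator (fun τ => ENNReal.ofReal (τ ^ (-m))) τ *
      (volume (Metric.closedBall (x τ) ((2 * L) * τ ^ (1 + β))) *
        volume (Metric.closedBall v ((2 * L) * τ ^ β)))
      = ENNReal.ofReal (coneConst d L *
        (c ^ (1 + d * (1 + 2 * β) - m) / (1 + d * (1 + 2 * β) - m))) := by
  calc _ = ∫⁻ τ, (Ioo 0 c).indicator (fun τ => ENNReal.ofReal (coneConst d L) *
        ENNReal.ofReal (τ ^ ((1 + d * (1 + 2 * β) - m) - 1))) τ := by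
        refine lintegral_congr fun τ => ?_
        by_cases hτ : τ ∈ Ioo 0 c
        · rw [indicator_of_mem hτ, indicator_of_mem hτ, volume_slice_eq _ _ (by positivity) hτ.1,
            mul_left_comm, ← ENNReal.ofReal_mul (Real.rpow_nonneg hτ.1.le _),
            ← Real.rpow_add hτ.1, coneConst]
          congr 3; ring
        · rw [indicator_of_notMem hτ, indicator_of_notMem hτ, zero_mul]
    _ = _ := by
        rw [lintegral_indicator measurableSet_Ioo, lintegral_const_mul _ (by fun_prop),
          lintegral_rpow_Ioo (by linarith) hc, ENNReal.ofReal_mul (by unfold coneConst; positivity)]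

/-- The tail counterpart, convergent because m' exceeds the homogeneous dimension; it serves with m'
= m s, where s is the dual exponent. -/
theorem lintegral_slice_far {m' : ℝ} (hL : 0 ≤ L) (hm : 1 + d * (1 + 2 * β) < m') {c : ℝ}
    (hc : 0 < c) (x : ℝ → Vel d) (v : Vel d) :
    ∫⁻ τ, (Ici c).indicator (fun τ => ENNReal.ofReal (τ ^ (-m'))) τ *
      (volume (Metric.closedBall (x τ) ((2 * L) * τ ^ (1 + β))) *
        volume (Metric.closedBall v ((2 * L) * τ ^ β)))
      = ENNReal.ofReal (coneConst d L *
        (c ^ (-(m' - (1 + d * (1 + 2 * β)))) / (m' - (1 + d * (1 + 2 * β))))) := by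
  calc _ = ∫⁻ τ, (Ici c).indicator (fun τ => ENNReal.ofReal (coneConst d L) *
        ENNReal.ofReal (τ ^ (-(m' - (1 + d * (1 + 2 * β))) - 1))) τ := by
        refine lintegral_congr fun τ => ?_
        by_cases hτ : τ ∈ Ici c
        · have h0 : 0 < τ := hc.trans_le hτ
          rw [indicator_of_mem hτ, indicator_of_mem hτ, volume_slice_eq _ _ (by positivity) h0,
            mul_left_comm, ← ENNReal.ofReal_mul (Real.rpow_nonneg h0.le _),
            ← Real.rpow_add h0, coneConst]
          congr 3; ring
        · rw [indicator_of_notMem hτ, indicator_of_notMem hτ, zero_mul]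
    _ = _ := by
        rw [lintegral_indicator measurableSet_Ici, lintegral_const_mul _ (by fun_prop),
          lintegral_rpow_Ici (by linarith) hc, ENNReal.ofReal_mul (by unfold coneConst; positivity)]

/-- Pairs of points with time lag less than `c`. -/
def nearSet (d : ℕ) (c : ℝ) : Set (Phase d × Phase d) := {z | z.1.1 - z.2.1 < c}

theorem measurableSet_nearSet (d : ℕ) (c : ℝ) : MeasurableSet (nearSet d c) :=
  measurableSet_lt (by fun_prop) (by fun_prop)

theorem indicator_near_le {c : ℝ} (z₀ z : Phase d) :
    (nearSet d c).indicator (kineticKernel β L m) (z₀, z)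
      ≤ (Ioo 0 c).indicator (fun τ => ENNReal.ofReal (τ ^ (-m))) (z₀.1 - z.1) := by
  by_cases hn : (z₀, z) ∈ nearSet d c
  · rw [indicator_of_mem hn]
    by_cases h : relCoord z₀ z ∈ kineticCone d β L
    · rw [kineticKernel_eq h, indicator_of_mem]
      exact ⟨h.1, hn⟩
    · rw [kineticKernel_eq_zero h]; exact zero_le
  · rw [indicator_of_notMem hn]; exact zero_le

theorem relCoord_mem_of_indicator_ne_zero {S : Set (Phase d × Phase d)} {z₀ z : Phase d}
    (h : S.indicator (kineticKernel β L m) (z₀, z) ≠ 0) : relCoord z₀ z ∈ kineticCone d β L := by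
  by_contra hcon
  refine h ?_
  by_cases hn : (z₀, z) ∈ S
  · rw [indicator_of_mem hn, kineticKernel_eq_zero hcon]
  · rw [indicator_of_notMem hn]

theorem lintegral_kineticKernel_near (hL : 0 ≤ L) (hm : m < 1 + d * (1 + 2 * β)) {c : ℝ}
    (hc : 0 < c) (z₀ : Phase d) :
    ∫⁻ z, (nearSet d c).indicator (kineticKernel β L m) (z₀, z)
      ≤ ENNReal.ofReal (coneConst d L *
        (c ^ (1 + d * (1 + 2 * β) - m) / (1 + d * (1 + 2 * β) - m))) := by
  have hmeas : Measurable fun z => (nearSet d c).indicator (kineticKernel β L m) (z₀, z) :=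
    ((measurable_kineticKernel β L m).indicator (measurableSet_nearSet d c)).comp
      measurable_prodMk_left
  refine (lintegral_phase_le hmeas
    (h := fun t => (Ioo 0 c).indicator (fun τ => ENNReal.ofReal (τ ^ (-m))) (z₀.1 - t))
    (a := fun t => (2 * L) * (z₀.1 - t) ^ (1 + β)) (b := fun t => (2 * L) * (z₀.1 - t) ^ β)
    (c := fun t => z₀.2.1 - (z₀.1 - t) • z₀.2.2) (v₀ := z₀.2.2)
    (fun z hz => mem_ball_of_relCoord_mem hL (relCoord_mem_of_indicator_ne_zero hz))
    (fun z => indicator_near_le z₀ z)).trans ?_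
  rw [lintegral_sub_left_eq_self (μ := volume) (fun τ : ℝ =>
    (Ioo 0 c).indicator (fun τ => ENNReal.ofReal (τ ^ (-m))) τ *
      (volume (Metric.closedBall (z₀.2.1 - τ • z₀.2.2) ((2 * L) * τ ^ (1 + β))) *
        volume (Metric.closedBall z₀.2.2 ((2 * L) * τ ^ β)))) z₀.1]
  exact (lintegral_slice_near hL hm hc (fun τ => z₀.2.1 - τ • z₀.2.2) z₀.2.2).le

theorem lintegral_kineticKernel_near' (hL : 0 ≤ L) (hm : m < 1 + d * (1 + 2 * β)) {c : ℝ}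
    (hc : 0 < c) (z : Phase d) :
    ∫⁻ z₀, (nearSet d c).indicator (kineticKernel β L m) (z₀, z)
      ≤ ENNReal.ofReal (coneConst d L *
        (c ^ (1 + d * (1 + 2 * β) - m) / (1 + d * (1 + 2 * β) - m))) := by
  have hmeas : Measurable fun z₀ => (nearSet d c).indicator (kineticKernel β L m) (z₀, z) :=
    ((measurable_kineticKernel β L m).indicator (measurableSet_nearSet d c)).comp
      measurable_prodMk_right
  refine (lintegral_phase_le hmeas
    (h := fun t => (Ioo 0 c).indicator (fun τ => ENNReal.ofReal (τ ^ (-m))) (t - z.1))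
    (a := fun t => (2 * L) * (t - z.1) ^ (1 + β)) (b := fun t => (2 * L) * (t - z.1) ^ β)
    (c := fun t => z.2.1 + (t - z.1) • z.2.2) (v₀ := z.2.2)
    (fun z₀ hz => mem_ball_of_relCoord_mem' hL (relCoord_mem_of_indicator_ne_zero hz))
    (fun z₀ => indicator_near_le z₀ z)).trans ?_
  rw [lintegral_sub_right_eq_self (μ := volume) (fun τ : ℝ =>
    (Ioo 0 c).indicator (fun τ => ENNReal.ofReal (τ ^ (-m))) τ *
      (volume (Metric.closedBall (z.2.1 + τ • z.2.2) ((2 * L) * τ ^ (1 + β))) *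
        volume (Metric.closedBall z.2.2 ((2 * L) * τ ^ β)))) z.1]
  exact (lintegral_slice_near hL hm hc (fun τ => z.2.1 + τ • z.2.2) z.2.2).le

theorem lintegral_kineticKernel_far {s : ℝ} (hL : 0 ≤ L) (hs : 0 < s)
    (hm : 1 + d * (1 + 2 * β) < m * s) {c : ℝ} (hc : 0 < c) (z₀ : Phase d) :
    ∫⁻ z, (nearSet d c)ᶜ.indicator (kineticKernel β L m) (z₀, z) ^ s
      ≤ ENNReal.ofReal (coneConst d L *
        (c ^ (-(m * s - (1 + d * (1 + 2 * β)))) / (m * s - (1 + d * (1 + 2 * β))))) := by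
  have hmeas : Measurable fun z => (nearSet d c)ᶜ.indicator (kineticKernel β L m) (z₀, z) ^ s :=
    (((measurable_kineticKernel β L m).indicator (measurableSet_nearSet d c).compl).comp
      measurable_prodMk_left).pow_const s
  refine (lintegral_phase_le hmeas
    (h := fun t => (Ici c).indicator (fun τ => ENNReal.ofReal (τ ^ (-(m * s)))) (z₀.1 - t))
    (a := fun t => (2 * L) * (z₀.1 - t) ^ (1 + β)) (b := fun t => (2 * L) * (z₀.1 - t) ^ β)
    (c := fun t => z₀.2.1 - (z₀.1 - t) • z₀.2.2) (v₀ := z₀.2.2)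
    (fun z hz => mem_ball_of_relCoord_mem hL (relCoord_mem_of_indicator_ne_zero
      (S := (nearSet d c)ᶜ) (fun h0 => hz (by rw [h0, ENNReal.zero_rpow_of_pos hs]))))
    (fun z => ?_)).trans ?_
  · by_cases hn : (z₀, z) ∈ (nearSet d c)ᶜ
    · rw [indicator_of_mem hn]
      have hc' : z₀.1 - z.1 ∈ Ici c := not_lt.mp (show ¬ z₀.1 - z.1 < c from hn)
      by_cases h : relCoord z₀ z ∈ kineticCone d β L
      · have h0 : 0 < z₀.1 - z.1 := h.1
        rw [kineticKernel_eq h, indicator_of_mem hc', ENNReal.ofReal_rpow_of_pos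
          (Real.rpow_pos_of_pos h0 _), ← Real.rpow_mul h0.le, neg_mul]
      · rw [kineticKernel_eq_zero h, ENNReal.zero_rpow_of_pos hs]; exact zero_le
    · rw [indicator_of_notMem hn, ENNReal.zero_rpow_of_pos hs]; exact zero_le
  · rw [lintegral_sub_left_eq_self (μ := volume) (fun τ : ℝ =>
      (Ici c).indicator (fun τ => ENNReal.ofReal (τ ^ (-(m * s)))) τ *
        (volume (Metric.closedBall (z₀.2.1 - τ • z₀.2.2) ((2 * L) * τ ^ (1 + β))) *
          volume (Metric.closedBall z₀.2.2 ((2 * L) * τ ^ β)))) z₀.1]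
    exact (lintegral_slice_far hL hm hc (fun τ => z₀.2.1 - τ • z₀.2.2) z₀.2.2).le

end KernelBounds

/-! ### Hardy–Littlewood–Sobolev on the kinetic cone -/

/-- Hardy–Littlewood–Sobolev inequality for the kinetic kernels. -/
theorem exists_kineticKernel_bound {d : ℕ} {β L m p q : ℝ} (hβ : 0 < β) (hL : 0 ≤ L) (hp : 1 < p)
    (hpq : p < q) (hm : m = (1 + d * (1 + 2 * β)) * (1 - 1 / p + 1 / q)) :
    ∃ C : ℝ, 0 < C ∧ ∀ (T : ℝ) (g : Phase d → ℝ≥0∞), AEMeasurable g (halfMeasure d T) →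
      (∫⁻ z₀, (∫⁻ z, kineticKernel β L m (z₀, z) * g z ∂(halfMeasure d T)) ^ q
          ∂(halfMeasure d T)) ^ (1 / q)
        ≤ ENNReal.ofReal C * (∫⁻ z, g z ^ p ∂(halfMeasure d T)) ^ (1 / p) := by
  set M : ℝ := 1 + d * (1 + 2 * β) with hM
  have hM0 : 0 < M := by positivity
  have hp0 : 0 < p := by linarith
  have hq0 : 0 < q := by linarith
  have hp1 : 0 < p - 1 := by linarith
  have hqp : 0 < q - q / p := by
    have : q / p < q := div_lt_self hq0 hp
    linarith
  have hmM : M - m = M * (1 / p - 1 / q) := by rw [hm]; ring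
  have hpq' : 0 < 1 / p - 1 / q := sub_pos.mpr (one_div_lt_one_div_of_lt hp0 hpq)
  have hMm : 0 < M - m := by rw [hmM]; positivity
  set s : ℝ := p / (p - 1) with hs
  have hs0 : 0 < s := by positivity
  have hms : m * s - M = M * s / q := by rw [hm, hs]; field_simp; ring
  have hms0 : 0 < m * s - M := by rw [hms]; positivity
  have hK : 0 ≤ coneConst d L := by unfold coneConst; positivity
  set A₁ : ℝ := coneConst d L / (M - m) with hA₁
  set A₂ : ℝ := (coneConst d L / (m * s - M)) ^ (1 / s) with hA₂
  have hA₁0 : 0 ≤ A₁ := by positivity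
  have hA₂0 : 0 ≤ A₂ := by positivity
  set A : ℝ := A₁ + A₂ with hAdef
  refine ⟨((2 * A + 1) ^ q * (q * A / (q - q / p))) ^ (1 / q) + 1, by positivity,
    fun T g hg => ?_⟩
  have hle : halfMeasure d T ≤ volume := Measure.restrict_le_self
  -- The splitting time is c = l ^ (-(q / M)): the dual norm of the far kernel scales like c ^ (-(M
  -- / q)), which is then l, and the near mass scales like c ^ (M - m), which is then l ^ (1 - q /
  -- p).
  have hc : ∀ l : ℝ, 0 < l → 0 < l ^ (-(q / M)) := fun l hl => Real.rpow_pos_of_pos hl _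
  have near_le : ∀ l : ℝ, 0 < l →
      ENNReal.ofReal (coneConst d L * ((l ^ (-(q / M))) ^ (M - m) / (M - m)))
        ≤ ENNReal.ofReal (A * l ^ (1 - q / p)) := by
    intro l hl
    refine ENNReal.ofReal_le_ofReal ?_
    rw [← Real.rpow_mul hl.le, show -(q / M) * (M - m) = 1 - q / p by rw [hmM]; field_simp; ring]
    have : 0 ≤ A₂ * l ^ (1 - q / p) := by positivity
    calc _ = A₁ * l ^ (1 - q / p) := by rw [hA₁]; ring
      _ ≤ _ := by rw [hAdef, add_mul]; linarith
  have : SFinite (halfMeasure d T) := by unfold halfMeasure; infer_instance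
  refine exists_lintegral_kernel_le hp hpq (by positivity) (measurable_kineticKernel β L m)
    (S := fun l => nearSet d (l ^ (-(q / M)))) (fun l _ => measurableSet_nearSet d _)
    (fun l hl x => ?_) (fun l hl y => ?_) (fun l hl x => ?_) hg
  · exact (lintegral_mono' hle le_rfl).trans
      ((lintegral_kineticKernel_near hL (by linarith) (hc l hl) x).trans (near_le l hl))
  · exact (lintegral_mono' hle le_rfl).trans
      ((lintegral_kineticKernel_near' hL (by linarith) (hc l hl) y).trans (near_le l hl))
  · have hfar := (lintegral_mono' hle le_rfl).trans
      (lintegral_kineticKernel_far (β := β) (m := m) hL hs0 (by linarith) (hc l hl) x)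
    refine (ENNReal.rpow_le_rpow hfar (by positivity)).trans ?_
    rw [ENNReal.ofReal_rpow_of_nonneg
      (mul_nonneg hK (div_nonneg (Real.rpow_nonneg (hc l hl).le _) hms0.le)) (by positivity)]
    refine ENNReal.ofReal_le_ofReal ?_
    rw [← Real.rpow_mul hl.le, ← hM, show -(q / M) * -(m * s - M) = s by rw [hms]; field_simp,
      mul_div_left_comm, mul_comm, Real.mul_rpow (by positivity) (by positivity),
      ← Real.rpow_mul hl.le, mul_one_div_cancel hs0.ne', Real.rpow_one, ← hA₂]
    have : 0 ≤ A₁ * l := by positivity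
    rw [hAdef, add_mul]; linarith

/-! ### Derivative of the smooth step -/

section SmoothTransition

theorem deriv_smoothTransition_nonneg (x : ℝ) : 0 ≤ deriv Real.smoothTransition x :=
  Real.smoothTransition.monotone.deriv_nonneg

theorem differentiable_smoothTransition : Differentiable ℝ Real.smoothTransition :=
  (Real.smoothTransition.contDiff (n := 1)).differentiable one_ne_zero

theorem continuous_deriv_smoothTransition : Continuous (deriv Real.smoothTransition) :=
  (Real.smoothTransition.contDiff (n := 1)).continuous_deriv le_rfl

theorem deriv_smoothTransition_of_neg {x : ℝ} (hx : x < 0) : deriv Real.smoothTransition x = 0 := by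
  have : Real.smoothTransition =ᶠ[nhds x] fun _ => 0 := by
    filter_upwards [Iio_mem_nhds hx] with y hy
    exact Real.smoothTransition.zero_of_nonpos (le_of_lt hy)
  rw [this.deriv_eq, deriv_const]

theorem deriv_smoothTransition_of_one_lt {x : ℝ} (hx : 1 < x) :
    deriv Real.smoothTransition x = 0 := by
  have : Real.smoothTransition =ᶠ[nhds x] fun _ => 1 := by
    filter_upwards [Ioi_mem_nhds hx] with y hy
    exact Real.smoothTransition.one_of_one_le (le_of_lt hy)
  rw [this.deriv_eq, deriv_const]

theorem exists_deriv_smoothTransition_le :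
    ∃ C : ℝ, 0 < C ∧ ∀ x, deriv Real.smoothTransition x ≤ C := by
  have hc : HasCompactSupport (deriv Real.smoothTransition) := by
    refine HasCompactSupport.intro (isCompact_Icc (a := (0 : ℝ)) (b := 1)) fun x hx => ?_
    rcases lt_or_ge x 0 with h | h
    · exact deriv_smoothTransition_of_neg h
    · refine deriv_smoothTransition_of_one_lt ?_
      by_contra hcon
      exact hx ⟨h, not_lt.mp hcon⟩
  obtain ⟨C, hC⟩ := hc.exists_bound_of_continuous continuous_deriv_smoothTransition
  refine ⟨|C| + 1, by positivity, fun x => ?_⟩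
  have := hC x
  rw [Real.norm_eq_abs] at this
  linarith [le_abs_self (deriv Real.smoothTransition x), le_abs_self C]

end SmoothTransition

/-! ### The self-similar density and its continuity equation -/

section Density

variable {d : ℕ} (β : ℝ)

/-- The rescaled position `X = τ ^ (-(1 + β)) y`. -/
noncomputable def posVar (ζ : Phase d) : Vel d := ζ.1 ^ (-(1 + β)) • ζ.2.1

/-- The rescaled velocity `W = τ ^ (-β) w + (1 + β) X`. -/
noncomputable def velVar (ζ : Phase d) : Vel d := ζ.1 ^ (-β) • ζ.2.2 + (1 + β) • posVar β ζ

/-- The energy `|X|² + |W|²`, conserved along the controlled trajectories. -/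
noncomputable def energy (ζ : Phase d) : ℝ := ‖posVar β ζ‖ ^ 2 + ‖velVar β ζ‖ ^ 2

/-- The self-similar density transported by the controlled trajectories. -/
noncomputable def density (ζ : Phase d) : ℝ :=
  ζ.1 ^ (-(d * (1 + 2 * β))) * Real.smoothTransition (1 - energy β ζ)

/-- The acceleration of the controlled trajectories. -/
noncomputable def steering (ζ : Phase d) : Vel d :=
  ζ.1 ^ (β - 1) • (posVar β ζ + (1 + β) • velVar β ζ + β • ζ.1 ^ (-β) • ζ.2.2)

variable {β} {ζ : Phase d}

theorem contDiffAt_rpow_fst (r : ℝ) (h : 0 < ζ.1) :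
    ContDiffAt ℝ ∞ (fun ζ : Phase d => ζ.1 ^ r) ζ :=
  contDiffAt_fst.rpow_const_of_ne h.ne'

theorem contDiffAt_posVar (h : 0 < ζ.1) : ContDiffAt ℝ ∞ (posVar (d := d) β) ζ :=
  (contDiffAt_rpow_fst _ h).smul (contDiffAt_fst.comp ζ contDiffAt_snd)

theorem contDiffAt_velVar (h : 0 < ζ.1) : ContDiffAt ℝ ∞ (velVar (d := d) β) ζ :=
  ((contDiffAt_rpow_fst _ h).smul (contDiffAt_snd.comp ζ contDiffAt_snd)).add
    ((contDiffAt_posVar h).const_smul _)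

theorem contDiffAt_energy (h : 0 < ζ.1) : ContDiffAt ℝ ∞ (energy (d := d) β) ζ :=
  ((contDiffAt_posVar h).norm_sq ℝ).add ((contDiffAt_velVar h).norm_sq ℝ)

theorem contDiffAt_density (h : 0 < ζ.1) : ContDiffAt ℝ ∞ (density (d := d) β) ζ :=
  (contDiffAt_rpow_fst _ h).mul
    (Real.smoothTransition.contDiffAt.comp ζ (contDiffAt_const.sub (contDiffAt_energy h)))

theorem contDiffAt_steering (h : 0 < ζ.1) : ContDiffAt ℝ ∞ (steering (d := d) β) ζ :=
  (contDiffAt_rpow_fst _ h).smul (((contDiffAt_posVar h).add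
    ((contDiffAt_velVar h).const_smul _)).add
      (((contDiffAt_rpow_fst _ h).smul (contDiffAt_snd.comp ζ contDiffAt_snd)).const_smul _))

theorem hasFDerivAt_rpow_fst (r : ℝ) (h : 0 < ζ.1) :
    HasFDerivAt (fun ζ : Phase d => ζ.1 ^ r)
      ((r * ζ.1 ^ (r - 1)) • ContinuousLinearMap.fst ℝ ℝ (Vel d × Vel d)) ζ :=
  (hasFDerivAt_fst (𝕜 := ℝ) (p := ζ)).rpow_const (Or.inl h.ne')

theorem fderiv_posVar (h : 0 < ζ.1) (δ : Phase d) :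
    fderiv ℝ (posVar β) ζ δ = ζ.1 ^ (-(1 + β)) • δ.2.1
      + (-(1 + β) * ζ.1 ^ (-(1 + β) - 1) * δ.1) • ζ.2.1 := by
  have h1 : HasFDerivAt (fun ζ : Phase d => ζ.2.1) ((ContinuousLinearMap.fst ℝ _ _).comp
      (ContinuousLinearMap.snd ℝ ℝ (Vel d × Vel d))) ζ :=
    ((ContinuousLinearMap.fst ℝ (Vel d) (Vel d)).comp
      (ContinuousLinearMap.snd ℝ ℝ (Vel d × Vel d))).hasFDerivAt
  have h2 : HasFDerivAt (posVar β) _ ζ := (hasFDerivAt_rpow_fst (-(1 + β)) h).smul h1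
  rw [h2.fderiv]
  simp

theorem fderiv_rpow_smul_vel (r : ℝ) (h : 0 < ζ.1) (δ : Phase d) :
    fderiv ℝ (fun ζ : Phase d => ζ.1 ^ r • ζ.2.2) ζ δ = ζ.1 ^ r • δ.2.2
      + (r * ζ.1 ^ (r - 1) * δ.1) • ζ.2.2 := by
  have h1 : HasFDerivAt (fun ζ : Phase d => ζ.2.2) ((ContinuousLinearMap.snd ℝ _ _).comp
      (ContinuousLinearMap.snd ℝ ℝ (Vel d × Vel d))) ζ :=
    ((ContinuousLinearMap.snd ℝ (Vel d) (Vel d)).comp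
      (ContinuousLinearMap.snd ℝ ℝ (Vel d × Vel d))).hasFDerivAt
  have h2 : HasFDerivAt (fun ζ : Phase d => ζ.1 ^ r • ζ.2.2) _ ζ :=
    (hasFDerivAt_rpow_fst r h).smul h1
  rw [h2.fderiv]
  simp

theorem differentiableAt_rpow_smul_vel (r : ℝ) (h : 0 < ζ.1) :
    DifferentiableAt ℝ (fun ζ : Phase d => ζ.1 ^ r • ζ.2.2) ζ :=
  ((contDiffAt_rpow_fst r h).smul (contDiffAt_snd.comp ζ contDiffAt_snd)).differentiableAt
    (by simp)

theorem fderiv_velVar (h : 0 < ζ.1) (δ : Phase d) :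
    fderiv ℝ (velVar β) ζ δ = ζ.1 ^ (-β) • δ.2.2 + (-β * ζ.1 ^ (-β - 1) * δ.1) • ζ.2.2
      + (1 + β) • fderiv ℝ (posVar β) ζ δ := by
  have h2 := (contDiffAt_posVar (β := β) h).differentiableAt (by simp)
  have h1 := differentiableAt_rpow_smul_vel (-β) h
  have h3 : HasFDerivAt (velVar β) (fderiv ℝ (fun ζ : Phase d => ζ.1 ^ (-β) • ζ.2.2) ζ
      + (1 + β) • fderiv ℝ (posVar β) ζ) ζ :=
    h1.hasFDerivAt.add (h2.hasFDerivAt.const_smul (1 + β))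
  rw [h3.fderiv, add_apply, smul_apply, fderiv_rpow_smul_vel _ h]

theorem fderiv_energy (h : 0 < ζ.1) (δ : Phase d) :
    fderiv ℝ (energy β) ζ δ = 2 * inner ℝ (posVar β ζ) (fderiv ℝ (posVar β) ζ δ)
      + 2 * inner ℝ (velVar β ζ) (fderiv ℝ (velVar β) ζ δ) := by
  have h1 := ((contDiffAt_posVar (β := β) h).differentiableAt (by simp)).hasFDerivAt.norm_sq
  have h2 := ((contDiffAt_velVar (β := β) h).differentiableAt (by simp)).hasFDerivAt.norm_sq
  have h3 : HasFDerivAt (energy β) _ ζ := h1.add h2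
  rw [h3.fderiv]
  simp

theorem fderiv_density (h : 0 < ζ.1) (δ : Phase d) :
    fderiv ℝ (density β) ζ δ =
      -(ζ.1 ^ (-(d * (1 + 2 * β))) * deriv Real.smoothTransition (1 - energy β ζ)
        * fderiv ℝ (energy β) ζ δ)
      - d * (1 + 2 * β) / ζ.1 * density β ζ * δ.1 := by
  have hE := ((contDiffAt_energy (β := β) h).differentiableAt (by simp)).hasFDerivAt
  have hS := (differentiable_smoothTransition (1 - energy β ζ)).hasDerivAt.comp_hasFDerivAt ζ
    (hE.const_sub 1)
  have h3 : HasFDerivAt (density β) _ ζ := (hasFDerivAt_rpow_fst (-(d * (1 + 2 * β))) h).mul hS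
  rw [h3.fderiv]
  simp only [density, add_apply, smul_apply, smul_eq_mul, neg_apply,
    ContinuousLinearMap.coe_fst']
  rw [Real.rpow_sub_one h.ne']
  ring

/-- The velocity derivative is scalar: W contributes 1 + β and the explicit velocity term
contributes β. The divergence of the steering is therefore d (1 + 2β) / τ, which the prefactor τ ^
(-(d (1 + 2β))) of the density balances. -/
theorem fderiv_steering_vel (h : 0 < ζ.1) (e : Vel d) :
    fderiv ℝ (steering β) ζ (0, 0, e) = ((1 + 2 * β) / ζ.1) • e := by
  have h1 := (contDiffAt_posVar (β := β) h).differentiableAt (by simp)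
  have h2 := (contDiffAt_velVar (β := β) h).differentiableAt (by simp)
  have h3 := differentiableAt_rpow_smul_vel (-β) h
  have h4 := hasFDerivAt_rpow_fst (β - 1) h
  have h5 : HasFDerivAt (steering β) _ ζ := h4.smul ((h1.hasFDerivAt.add
    (h2.hasFDerivAt.const_smul (1 + β))).add (h3.hasFDerivAt.const_smul β))
  rw [h5.fderiv]
  simp only [add_apply, smul_apply, fderiv_posVar h,
    fderiv_velVar h, fderiv_rpow_smul_vel _ h, ContinuousLinearMap.smulRight_apply,
    ContinuousLinearMap.coe_fst', mul_zero, zero_smul, smul_zero, add_zero, zero_add, smul_smul,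
    ← add_smul]
  congr 1
  have : ζ.1 ^ (β - 1) * ζ.1 ^ (-β) = ζ.1⁻¹ := by
    rw [← Real.rpow_add h, ← Real.rpow_neg_one]; congr 1; ring
  linear_combination ((1 + β) + β) * this

/-- The continuity equation for the density along the controlled trajectories. -/
theorem fderiv_density_transport (h : 0 < ζ.1) :
    fderiv ℝ (density β) ζ (-1, ζ.2.2, 0) = fderiv ℝ (density β) ζ (0, 0, steering β ζ)
      + d * (1 + 2 * β) / ζ.1 * density β ζ := by
  -- Conservation of energy: along the curves dX/dτ = -W / τ, and the steering is what makes dW/dτ =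
  -- X / τ, so the cross terms 2 ⟨X, W⟩ / τ cancel.
  have hE : fderiv ℝ (energy β) ζ (-1, ζ.2.2, 0)
      = fderiv ℝ (energy β) ζ (0, 0, steering β ζ) := by
    have hX : fderiv ℝ (posVar β) ζ (-1, ζ.2.2, 0) = ζ.1⁻¹ • velVar β ζ := by
      rw [fderiv_posVar h, velVar, posVar]
      simp only [smul_add, smul_smul]
      have e1 : ζ.1 ^ (-(1 + β)) = ζ.1⁻¹ * ζ.1 ^ (-β) := by
        rw [← Real.rpow_neg_one, ← Real.rpow_add h]; congr 1; ring
      rw [Real.rpow_sub_one h.ne', e1]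
      congr 2
      ring
    have hX' : fderiv ℝ (posVar β) ζ (0, 0, steering β ζ) = 0 := by
      rw [fderiv_posVar h]; simp
    rw [fderiv_energy h, fderiv_energy h, fderiv_velVar h, fderiv_velVar h, hX, hX']
    simp only [smul_zero, zero_add, add_zero, inner_zero_right, mul_zero, zero_smul, mul_neg,
      mul_one, neg_mul, neg_neg, steering, smul_smul, smul_add, inner_add_right,
      real_inner_smul_right]
    rw [real_inner_comm (posVar β ζ) (velVar β ζ)]
    have e1 : ζ.1 ^ (-β) * ζ.1 ^ (β - 1) = ζ.1⁻¹ := by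
      rw [← Real.rpow_add h, ← Real.rpow_neg_one]; congr 1; ring
    have e2 : ζ.1 ^ (-β - 1) = ζ.1⁻¹ * ζ.1 ^ (-β) := by
      rw [Real.rpow_sub_one h.ne']; ring
    rw [e2]
    linear_combination (-2) * (inner ℝ (posVar β ζ) (velVar β ζ) + (1 + β) *
      inner ℝ (velVar β ζ) (velVar β ζ) + β * ζ.1 ^ (-β) * inner ℝ (velVar β ζ) ζ.2.2) * e1
  rw [fderiv_density h, fderiv_density h, hE]
  ring

end Density

/-! ### Size of the density, its velocity gradient and the steering -/

section Bounds

variable {d : ℕ} {β : ℝ} {ζ : Phase d}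

theorem norm_posVar_le (hE : energy β ζ ≤ 1) : ‖posVar β ζ‖ ≤ 1 := by
  unfold energy at hE
  nlinarith [norm_nonneg (posVar β ζ), sq_nonneg ‖velVar β ζ‖]

theorem norm_velVar_le (hE : energy β ζ ≤ 1) : ‖velVar β ζ‖ ≤ 1 := by
  unfold energy at hE
  nlinarith [norm_nonneg (velVar β ζ), sq_nonneg ‖posVar β ζ‖]

theorem norm_rpow_smul_vel_le (hβ : 0 < β) (hE : energy β ζ ≤ 1) :
    ‖ζ.1 ^ (-β) • ζ.2.2‖ ≤ 2 + β := by
  have e : ζ.1 ^ (-β) • ζ.2.2 = velVar β ζ - (1 + β) • posVar β ζ := by rw [velVar]; abel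
  rw [e]
  refine (norm_sub_le _ _).trans ?_
  rw [norm_smul, Real.norm_of_nonneg (by positivity)]
  nlinarith [norm_posVar_le hE, norm_velVar_le hE]

/-- The aperture comes from τ ^ (-β) w = W - (1 + β) X with |X|, |W| ≤ 1, which gives |w| ≤ (2 + β)
τ ^ β. -/
theorem mem_kineticCone_of_energy_le (hβ : 0 < β) (h : 0 < ζ.1) (hE : energy β ζ ≤ 1) :
    ζ ∈ kineticCone d β (2 + β) := by
  refine ⟨h, ?_, ?_⟩
  · have h1 := norm_posVar_le hE
    rw [posVar, norm_smul, Real.norm_of_nonneg (Real.rpow_nonneg h.le _), Real.rpow_neg h.le,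
      inv_mul_le_iff₀ (Real.rpow_pos_of_pos h _)] at h1
    nlinarith [Real.rpow_pos_of_pos h (1 + β)]
  · have h1 := norm_rpow_smul_vel_le hβ hE
    rw [norm_smul, Real.norm_of_nonneg (Real.rpow_nonneg h.le _), Real.rpow_neg h.le,
      inv_mul_le_iff₀ (Real.rpow_pos_of_pos h _)] at h1
    linarith

theorem density_nonneg (h : 0 ≤ ζ.1) : 0 ≤ density β ζ :=
  mul_nonneg (Real.rpow_nonneg h _) (Real.smoothTransition.nonneg _)

theorem density_le (h : 0 ≤ ζ.1) : density β ζ ≤ ζ.1 ^ (-(d * (1 + 2 * β))) :=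
  mul_le_of_le_one_right (Real.rpow_nonneg h _) (Real.smoothTransition.le_one _)

theorem energy_le_of_density_ne_zero (h : density β ζ ≠ 0) : energy β ζ ≤ 1 := by
  by_contra hcon
  exact h (by rw [density, Real.smoothTransition.zero_of_nonpos (by linarith), mul_zero])

theorem norm_steering_le (hβ : 0 < β) (h : 0 < ζ.1) (hE : energy β ζ ≤ 1) :
    ‖steering β ζ‖ ≤ (2 + β + β * (2 + β)) * ζ.1 ^ (β - 1) := by
  rw [steering, norm_smul, Real.norm_of_nonneg (Real.rpow_nonneg h.le _), mul_comm]
  gcongr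
  refine (norm_add₃_le).trans ?_
  rw [norm_smul (1 + β), norm_smul β, Real.norm_of_nonneg (by positivity : 0 ≤ 1 + β),
    Real.norm_of_nonneg hβ.le]
  nlinarith [norm_posVar_le hE, norm_velVar_le hE, norm_rpow_smul_vel_le hβ hE]

/-- The velocity enters the energy only through W, with factor τ ^ (-β); this is the full cost of a
velocity derivative. -/
theorem fderiv_density_vel (h : 0 < ζ.1) (e : Vel d) :
    fderiv ℝ (density β) ζ (0, 0, e) = -(2 * ζ.1 ^ (-(d * (1 + 2 * β) + β)) *
      deriv Real.smoothTransition (1 - energy β ζ) * inner ℝ (velVar β ζ) e) := by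
  rw [fderiv_density h, fderiv_energy h, fderiv_velVar h, fderiv_posVar h]
  simp only [smul_zero, mul_zero, zero_smul, add_zero, inner_zero_right, real_inner_smul_right,
    zero_add, sub_zero]
  rw [neg_add, Real.rpow_add h]
  ring

theorem abs_fderiv_density_vel_le {C : ℝ} (hC : ∀ x, deriv Real.smoothTransition x ≤ C)
    (h : 0 < ζ.1) (hE : energy β ζ ≤ 1) (e : Vel d) :
    |fderiv ℝ (density β) ζ (0, 0, e)| ≤ 2 * C * ζ.1 ^ (-(d * (1 + 2 * β) + β)) * ‖e‖ := by
  have h0 := deriv_smoothTransition_nonneg (1 - energy β ζ)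
  have h1 := hC (1 - energy β ζ)
  have h2 := Real.rpow_pos_of_pos h (-(d * (1 + 2 * β) + β))
  have h3 : |inner ℝ (velVar β ζ) e| ≤ ‖e‖ := (abs_real_inner_le_norm _ _).trans
    (mul_le_of_le_one_left (norm_nonneg _) (norm_velVar_le hE))
  rw [fderiv_density_vel h, abs_neg, abs_mul, abs_mul, abs_mul, abs_of_pos h2, abs_of_nonneg h0,
    abs_two]
  calc _ ≤ 2 * ζ.1 ^ (-(d * (1 + 2 * β) + β)) * C * ‖e‖ := by
        have : 0 ≤ C := h0.trans h1
        gcongr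
    _ = _ := by ring

theorem fderiv_density_vel_eq_zero (h : 0 < ζ.1) (hE : 1 < energy β ζ) (e : Vel d) :
    fderiv ℝ (density β) ζ (0, 0, e) = 0 := by
  rw [fderiv_density_vel h, deriv_smoothTransition_of_neg (by linarith)]
  ring

end Bounds

/-! ### Test functions built from time cutoffs in moving coordinates -/

section Cutoff

variable {d : ℕ}

/-- The point with Galilean coordinates `ζ` relative to `z₀`. -/
def galShift (z₀ ζ : Phase d) : Phase d :=
  (z₀.1 - ζ.1, z₀.2.1 - ζ.1 • z₀.2.2 + ζ.2.1, z₀.2.2 + ζ.2.2)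

theorem galShift_relCoord (z₀ z : Phase d) : galShift z₀ (relCoord z₀ z) = z := by
  refine Prod.ext ?_ (Prod.ext ?_ ?_) <;> simp [galShift, relCoord]

theorem relCoord_galShift (z₀ ζ : Phase d) : relCoord z₀ (galShift z₀ ζ) = ζ := by
  refine Prod.ext ?_ (Prod.ext ?_ ?_) <;> simp [galShift, relCoord]
  abel

theorem continuous_galShift : Continuous fun z : Phase d × Phase d => galShift z.1 z.2 := by
  unfold galShift; fun_prop

/-- The linear part of `relCoord z₀`. -/
noncomputable def relLin (z₀ : Phase d) : Phase d →L[ℝ] Phase d :=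
  (-ContinuousLinearMap.fst ℝ ℝ (Vel d × Vel d)).prod
    (((ContinuousLinearMap.fst ℝ (Vel d) (Vel d)).comp (ContinuousLinearMap.snd ℝ ℝ _)
      - (ContinuousLinearMap.fst ℝ ℝ (Vel d × Vel d)).smulRight z₀.2.2).prod
    ((ContinuousLinearMap.snd ℝ (Vel d) (Vel d)).comp (ContinuousLinearMap.snd ℝ ℝ _)))

theorem relLin_apply (z₀ δ : Phase d) :
    relLin z₀ δ = (-δ.1, δ.2.1 - δ.1 • z₀.2.2, δ.2.2) := by
  simp [relLin]

theorem relCoord_eq (z₀ : Phase d) : relCoord z₀ =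
    fun z => relLin z₀ z + (z₀.1, -z₀.2.1 + z₀.1 • z₀.2.2, -z₀.2.2) := by
  funext z
  rw [relLin_apply]
  refine Prod.ext ?_ (Prod.ext ?_ ?_)
  · simp [relCoord]; ring
  · simp only [relCoord, sub_smul, Prod.mk_add_mk]; abel
  · simp only [relCoord, Prod.mk_add_mk]; abel

theorem hasFDerivAt_relCoord (z₀ z : Phase d) : HasFDerivAt (relCoord z₀) (relLin z₀) z := by
  rw [relCoord_eq]
  exact (relLin z₀).hasFDerivAt.add_const _

theorem contDiff_relCoord (z₀ : Phase d) : ContDiff ℝ ∞ (relCoord z₀) := by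
  rw [relCoord_eq]
  exact (relLin z₀).contDiff.add contDiff_const

variable {χ : ℝ → ℝ} {ε R : ℝ} {H : Phase d → ℝ}

theorem eventuallyEq_zero_of_cutoff (hε : 0 < ε) (hχε : ∀ τ, τ < ε → χ τ = 0) {ζ : Phase d}
    (h : ζ.1 ≤ 0) : (fun ζ : Phase d => χ ζ.1 * H ζ) =ᶠ[nhds ζ] fun _ => 0 := by
  have : {ζ : Phase d | ζ.1 < ε} ∈ nhds ζ :=
    (isOpen_lt continuous_fst continuous_const).mem_nhds (lt_of_le_of_lt h hε)
  filter_upwards [this] with ξ hξ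
  rw [hχε _ hξ, zero_mul]

/-- Powers of τ are smooth only for τ > 0. A cutoff vanishing for τ < ε makes the product
identically zero near every point with τ ≤ 0, so the values of H there are irrelevant. -/
theorem contDiff_cutoff_mul (hχ : ContDiff ℝ ∞ χ) (hε : 0 < ε) (hχε : ∀ τ, τ < ε → χ τ = 0)
    (hH : ∀ ζ : Phase d, 0 < ζ.1 → ContDiffAt ℝ ∞ H ζ) :
    ContDiff ℝ ∞ fun ζ : Phase d => χ ζ.1 * H ζ := by
  rw [contDiff_iff_contDiffAt]
  intro ζ
  rcases le_or_gt ζ.1 0 with h | h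
  · exact contDiffAt_const.congr_of_eventuallyEq (eventuallyEq_zero_of_cutoff hε hχε h)
  · exact (hχ.contDiffAt.comp ζ contDiffAt_fst).mul (hH ζ h)

theorem fderiv_cutoff_mul (hχ : ContDiff ℝ ∞ χ) (hε : 0 < ε) (hχε : ∀ τ, τ < ε → χ τ = 0)
    (hH : ∀ ζ : Phase d, 0 < ζ.1 → ContDiffAt ℝ ∞ H ζ) (ζ δ : Phase d) :
    fderiv ℝ (fun ζ : Phase d => χ ζ.1 * H ζ) ζ δ
      = deriv χ ζ.1 * δ.1 * H ζ + χ ζ.1 * fderiv ℝ H ζ δ := by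
  rcases le_or_gt ζ.1 0 with h | h
  · have h1 : χ =ᶠ[nhds ζ.1] fun _ => 0 := by
      filter_upwards [Iio_mem_nhds (lt_of_le_of_lt h hε)] with τ hτ
      exact hχε τ hτ
    rw [(eventuallyEq_zero_of_cutoff hε hχε h).fderiv_eq, h1.deriv_eq, h1.eq_of_nhds]
    simp
  · have h1 : HasFDerivAt (fun ζ : Phase d => χ ζ.1)
        (deriv χ ζ.1 • ContinuousLinearMap.fst ℝ ℝ (Vel d × Vel d)) ζ :=
      ((hχ.differentiable (by simp)) ζ.1).hasDerivAt.comp_hasFDerivAt ζ hasFDerivAt_fst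
    have h2 := ((hH ζ h).differentiableAt (by simp)).hasFDerivAt
    have h3 : HasFDerivAt (fun ζ : Phase d => χ ζ.1 * H ζ) _ ζ := h1.mul h2
    rw [h3.fderiv]
    simp only [add_apply, smul_apply, smul_eq_mul, ContinuousLinearMap.coe_fst']
    ring

variable {z₀ : Phase d} {T β L : ℝ}

/-- For lags in [ε, R] the cone is bounded, so the support lies in the Galilean image of a compact
product. That image is inside the half-space because its times are at most z₀.1 - ε. -/
theorem isTestFunction_cutoff_mul (hβ : 0 < β) (hL : 0 ≤ L) (hz₀ : z₀.1 < T)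
    (hχ : ContDiff ℝ ∞ χ) (hε : 0 < ε) (hχε : ∀ τ, τ < ε → χ τ = 0) (hχR : ∀ τ, R < τ → χ τ = 0)
    (hH : ∀ ζ : Phase d, 0 < ζ.1 → ContDiffAt ℝ ∞ H ζ)
    (hHs : ∀ ζ : Phase d, 0 < ζ.1 → H ζ ≠ 0 → ζ ∈ kineticCone d β L) :
    IsTestFunction (halfSpace d T) fun z => χ (relCoord z₀ z).1 * H (relCoord z₀ z) := by
  set K : Set (Phase d) := galShift z₀ '' (Icc ε R ×ˢ
    (Metric.closedBall 0 (L * R ^ (1 + β)) ×ˢ Metric.closedBall 0 (L * R ^ β))) with hK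
  have hKc : IsCompact K := by
    refine (isCompact_Icc.prod ((isCompact_closedBall _ _).prod (isCompact_closedBall _ _))).image
      (continuous_galShift.comp (Continuous.prodMk_right z₀))
  have hzero : ∀ z ∉ K, χ (relCoord z₀ z).1 * H (relCoord z₀ z) = 0 := by
    intro z hz
    by_contra hne
    have h1 : χ (relCoord z₀ z).1 ≠ 0 := left_ne_zero_of_mul hne
    have h2 : ε ≤ (relCoord z₀ z).1 := by
      by_contra hcon; exact h1 (hχε _ (not_le.mp hcon))
    have h3 : (relCoord z₀ z).1 ≤ R := by
      by_contra hcon; exact h1 (hχR _ (not_le.mp hcon))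
    obtain ⟨h4, h5, h6⟩ := hHs _ (hε.trans_le h2) (right_ne_zero_of_mul hne)
    refine hz ⟨relCoord z₀ z, ⟨⟨h2, h3⟩, ?_, ?_⟩, galShift_relCoord z₀ z⟩
    · rw [mem_closedBall_zero_iff]; exact h5.trans (by gcongr)
    · rw [mem_closedBall_zero_iff]; exact h6.trans (by gcongr)
  refine ⟨(contDiff_cutoff_mul hχ hε hχε hH).comp (contDiff_relCoord z₀),
    HasCompactSupport.intro hKc hzero, ?_⟩
  have hsub : tsupport (fun z => χ (relCoord z₀ z).1 * H (relCoord z₀ z)) ⊆ K := by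
    refine closure_minimal (fun z hz => ?_) hKc.isClosed
    by_contra hcon; exact hz (hzero z hcon)
  refine hsub.trans ?_
  · rintro _ ⟨ζ, ⟨⟨h1, _⟩, _⟩, rfl⟩
    simp only [halfSpace, galShift, mem_ofPred_eq]
    linarith

/-- Galilean invariance: the transport direction (1, v, 0) becomes (-1, v - v₀, 0), with only the
relative velocity left. -/
theorem transport_comp_relCoord {φ : Phase d → ℝ} (hφ : Differentiable ℝ φ) (z : Phase d) :
    transport (fun z => φ (relCoord z₀ z)) z
      = fderiv ℝ φ (relCoord z₀ z) (-1, (relCoord z₀ z).2.2, 0) := by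
  have : HasFDerivAt (fun z => φ (relCoord z₀ z)) _ z :=
    (hφ (relCoord z₀ z)).hasFDerivAt.comp z (hasFDerivAt_relCoord z₀ z)
  rw [transport, this.fderiv, ContinuousLinearMap.comp_apply, relLin_apply]
  simp [relCoord]

theorem velDeriv_comp_relCoord {φ : Phase d → ℝ} (hφ : Differentiable ℝ φ) (z : Phase d)
    (e : Vel d) :
    velDeriv (fun z => φ (relCoord z₀ z)) z e = fderiv ℝ φ (relCoord z₀ z) (0, 0, e) := by
  have : HasFDerivAt (fun z => φ (relCoord z₀ z)) _ z :=
    (hφ (relCoord z₀ z)).hasFDerivAt.comp z (hasFDerivAt_relCoord z₀ z)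
  rw [velDeriv, this.fderiv, ContinuousLinearMap.comp_apply, relLin_apply]
  simp

end Cutoff

/-! ### Integrability of the tested terms -/

section Integrability

variable {d : ℕ} {T : ℝ} {φ : Phase d → ℝ} {P : ℝ≥0∞}

theorem MeasureTheory.MemLp.integrable_mul_of_hasCompactSupport {g : Phase d → ℝ}
    (hg : MemLp g P (halfMeasure d T)) (hP : 1 ≤ P) (hφ : Continuous φ)
    (hc : HasCompactSupport φ) : Integrable (fun z => g z * φ z) (halfMeasure d T) := by
  have : IsLocallyFiniteMeasure (halfMeasure d T) := by unfold halfMeasure; infer_instance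
  have := (hg.locallyIntegrable hP).integrable_smul_left_of_hasCompactSupport hφ hc
  simpa [mul_comm] using this

theorem IsTestFunction.continuous_velDeriv {Ω : Set (Phase d)} (h : IsTestFunction Ω φ)
    (e : Vel d) : Continuous fun z => velDeriv φ z e :=
  (h.smooth.continuous_fderiv (by simp)).clm_apply continuous_const

theorem IsTestFunction.hasCompactSupport_velDeriv {Ω : Set (Phase d)} (h : IsTestFunction Ω φ)
    (e : Vel d) : HasCompactSupport fun z => velDeriv φ z e :=
  (h.compact.fderiv ℝ).comp_left (g := fun A : Phase d →L[ℝ] ℝ => A (0, 0, e)) (by simp)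

theorem IsTestFunction.continuous_transport {Ω : Set (Phase d)} (h : IsTestFunction Ω φ) :
    Continuous (transport φ) :=
  (h.smooth.continuous_fderiv (by simp)).clm_apply (by fun_prop)

theorem IsTestFunction.hasCompactSupport_transport {Ω : Set (Phase d)}
    (h : IsTestFunction Ω φ) : HasCompactSupport (transport φ) := by
  refine (h.compact.fderiv ℝ).mono fun z hz hcon => hz ?_
  simp [transport, hcon]

/-- Expansion in an orthonormal basis reduces pairings with vector fields to scalar test functions,
and identifies sums of directional derivatives with a velocity divergence. -/
theorem velDeriv_eq_sum (z : Phase d) (e : Vel d) :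
    velDeriv φ z e = ∑ i, inner ℝ e (EuclideanSpace.basisFun (Fin d) ℝ i)
      * velDeriv φ z (EuclideanSpace.basisFun (Fin d) ℝ i) := by
  set A : Vel d →L[ℝ] ℝ := (fderiv ℝ φ z).comp ((ContinuousLinearMap.inr ℝ ℝ _).comp
    (ContinuousLinearMap.inr ℝ (Vel d) (Vel d))) with hA
  have hAe : ∀ e, velDeriv φ z e = A e := fun e => by simp [velDeriv, hA]
  simp_rw [hAe]
  conv_lhs => rw [← (EuclideanSpace.basisFun (Fin d) ℝ).sum_repr' e]
  rw [map_sum]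
  refine Finset.sum_congr rfl fun i _ => ?_
  rw [map_smul, smul_eq_mul, real_inner_comm]

theorem IsTestFunction.integrable_velDeriv {Ω : Set (Phase d)} (h : IsTestFunction Ω φ)
    {S : Phase d → Vel d} (hS : MemLp S P (halfMeasure d T)) (hP : 1 ≤ P) :
    Integrable (fun z => velDeriv φ z (S z)) (halfMeasure d T) := by
  simp_rw [velDeriv_eq_sum (φ := φ) _ (S _)]
  refine integrable_finsetSum _ fun i _ => ?_
  exact (hS.inner_const _).integrable_mul_of_hasCompactSupport hP (h.continuous_velDeriv _)
    (h.hasCompactSupport_velDeriv _)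

end Integrability

/-! ### The representation inequality -/

section Representation

variable {d : ℕ} {β ε R T : ℝ} {χ : ℝ → ℝ} {z₀ : Phase d}

theorem contDiffAt_density_mul_steering (e : Vel d) {ζ : Phase d} (h : 0 < ζ.1) :
    ContDiffAt ℝ ∞ (fun ζ => density β ζ * inner ℝ (steering β ζ) e) ζ :=
  (contDiffAt_density h).mul ((contDiffAt_steering h).inner ℝ contDiffAt_const)

theorem fderiv_density_mul_steering (e : Vel d) {ζ : Phase d} (h : 0 < ζ.1) :
    fderiv ℝ (fun ζ => density β ζ * inner ℝ (steering β ζ) e) ζ (0, 0, e)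
      = inner ℝ (steering β ζ) e * fderiv ℝ (density β) ζ (0, 0, e)
        + density β ζ * ((1 + 2 * β) / ζ.1) * ‖e‖ ^ 2 := by
  have h1 := ((contDiffAt_density (β := β) h).differentiableAt (by simp)).hasFDerivAt
  have h2 := ((contDiffAt_steering (β := β) h).differentiableAt (by simp)).hasFDerivAt.inner ℝ
    (hasFDerivAt_const e ζ)
  have h3 : HasFDerivAt (fun ζ => density β ζ * inner ℝ (steering β ζ) e) _ ζ := h1.mul h2
  rw [h3.fderiv]
  simp only [add_apply, smul_apply, smul_eq_mul, ContinuousLinearMap.comp_apply,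
    ContinuousLinearMap.prod_apply, fderivInnerCLM_apply, zero_apply, inner_zero_right, zero_add,
    fderiv_steering_vel h, real_inner_smul_left, real_inner_self_eq_norm_sq]
  ring

theorem differentiable_cutoff_mul (hχ : ContDiff ℝ ∞ χ) (hε : 0 < ε)
    (hχε : ∀ τ, τ < ε → χ τ = 0) {H : Phase d → ℝ}
    (hH : ∀ ζ : Phase d, 0 < ζ.1 → ContDiffAt ℝ ∞ H ζ) :
    Differentiable ℝ fun ζ : Phase d => χ ζ.1 * H ζ :=
  (contDiff_cutoff_mul hχ hε hχε hH).differentiable (by simp)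

theorem velDeriv_cutoff_mul (hχ : ContDiff ℝ ∞ χ) (hε : 0 < ε)
    (hχε : ∀ τ, τ < ε → χ τ = 0) {H : Phase d → ℝ}
    (hH : ∀ ζ : Phase d, 0 < ζ.1 → ContDiffAt ℝ ∞ H ζ) (z : Phase d) (e : Vel d) :
    velDeriv (fun z => χ (relCoord z₀ z).1 * H (relCoord z₀ z)) z e
      = χ (relCoord z₀ z).1 * fderiv ℝ H (relCoord z₀ z) (0, 0, e) := by
  rw [velDeriv_comp_relCoord (φ := fun ζ => χ ζ.1 * H ζ)
    (differentiable_cutoff_mul hχ hε hχε hH), fderiv_cutoff_mul hχ hε hχε hH]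
  simp

/-- The transport derivative of the cut-off density is, up to the time derivative of the cutoff,
a velocity divergence. -/
theorem transport_cutoff_density (hχ : ContDiff ℝ ∞ χ) (hε : 0 < ε)
    (hχε : ∀ τ, τ < ε → χ τ = 0) (z : Phase d) :
    -transport (fun z => χ (relCoord z₀ z).1 * density β (relCoord z₀ z)) z
      = deriv χ (relCoord z₀ z).1 * density β (relCoord z₀ z)
        - ∑ i, velDeriv (fun z => χ (relCoord z₀ z).1 * (density β (relCoord z₀ z) *
            inner ℝ (steering β (relCoord z₀ z)) (EuclideanSpace.basisFun (Fin d) ℝ i))) z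
            (EuclideanSpace.basisFun (Fin d) ℝ i) := by
  rw [transport_comp_relCoord (φ := fun ζ => χ ζ.1 * density β ζ)
    (differentiable_cutoff_mul hχ hε hχε fun ζ h => contDiffAt_density h),
    fderiv_cutoff_mul hχ hε hχε (fun ζ h => contDiffAt_density h)]
  simp_rw [velDeriv_cutoff_mul hχ hε hχε (z₀ := z₀)
    (H := fun ζ => density β ζ * inner ℝ (steering β ζ) (EuclideanSpace.basisFun (Fin d) ℝ _))
    (fun ζ h => contDiffAt_density_mul_steering _ h)]
  set ζ := relCoord z₀ z
  by_cases h0 : χ ζ.1 = 0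
  · simp [h0]
  have h : 0 < ζ.1 := by
    by_contra hcon; exact h0 (hχε _ (lt_of_le_of_lt (not_lt.mp hcon) hε))
  -- This is div_w(ρ u) = u · ∇_w ρ + ρ div_w u, the right-hand side of the continuity equation.
  have hsum : ∑ i, fderiv ℝ (fun ζ => density β ζ * inner ℝ (steering β ζ)
      (EuclideanSpace.basisFun (Fin d) ℝ i)) ζ (0, 0, EuclideanSpace.basisFun (Fin d) ℝ i)
      = fderiv ℝ (density β) ζ (0, 0, steering β ζ)
        + d * (1 + 2 * β) / ζ.1 * density β ζ := by
    simp_rw [fderiv_density_mul_steering _ h]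
    rw [Finset.sum_add_distrib]
    congr 1
    · exact (velDeriv_eq_sum (φ := density β) ζ (steering β ζ)).symm
    · simp only [OrthonormalBasis.norm_eq_one, Finset.sum_const, Finset.card_univ,
        Fintype.card_fin, nsmul_eq_mul]
      ring
  rw [← Finset.mul_sum, hsum, fderiv_density_transport h]
  ring

/-- The subsolution is tested with χ ρ. By the continuity equation the transport term is -χ' ρ plus
a velocity divergence, and the latter is integrated by parts onto the weak gradient, so no
derivative of f in t or x is needed. -/
theorem integral_deriv_cutoff_le (hχ : ContDiff ℝ ∞ χ) (hε : 0 < ε)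
    (hχε : ∀ τ, τ < ε → χ τ = 0) (hβ : 0 < β) (hz₀ : z₀.1 < T)
    (hχ0 : ∀ τ, 0 ≤ χ τ) (hχR : ∀ τ, R < τ → χ τ = 0)
    {f S₁ : Phase d → ℝ} {G S₀ : Phase d → Vel d} {p₁ p₂ p₃ p₄ : ℝ≥0∞}
    (hp₁ : 1 ≤ p₁) (hp₂ : 1 ≤ p₂) (hp₃ : 1 ≤ p₃) (hp₄ : 1 ≤ p₄)
    (hf : MemLp f p₁ (halfMeasure d T)) (hG : MemLp G p₂ (halfMeasure d T))
    (hS₀ : MemLp S₀ p₃ (halfMeasure d T)) (hS₁ : MemLp S₁ p₄ (halfMeasure d T))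
    (hfG : IsWeakVelGrad T f G) (hsub : IsWeakSubsolution T f S₀ S₁) :
    ∫ z, f z * (deriv χ (relCoord z₀ z).1 * density β (relCoord z₀ z)) ∂(halfMeasure d T)
      ≤ ∫ z, χ (relCoord z₀ z).1 * (S₁ z * density β (relCoord z₀ z)
          - density β (relCoord z₀ z) * inner ℝ (G z) (steering β (relCoord z₀ z))
          - fderiv ℝ (density β) (relCoord z₀ z) (0, 0, S₀ z)) ∂(halfMeasure d T) := by
  set b := EuclideanSpace.basisFun (Fin d) ℝ with hb
  set φ : Phase d → ℝ := fun z => χ (relCoord z₀ z).1 * density β (relCoord z₀ z) with hφdef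
  set ψ : Fin d → Phase d → ℝ := fun i z => χ (relCoord z₀ z).1 * (density β (relCoord z₀ z) *
    inner ℝ (steering β (relCoord z₀ z)) (b i)) with hψdef
  have hcone : ∀ ζ : Phase d, 0 < ζ.1 → density β ζ ≠ 0 → ζ ∈ kineticCone d β (2 + β) :=
    fun ζ h hne => mem_kineticCone_of_energy_le hβ h (energy_le_of_density_ne_zero hne)
  have hφ : IsTestFunction (halfSpace d T) φ :=
    isTestFunction_cutoff_mul hβ (by positivity) hz₀ hχ hε hχε hχR
      (fun ζ h => contDiffAt_density h) hcone
  have hψ : ∀ i, IsTestFunction (halfSpace d T) (ψ i) := fun i =>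
    isTestFunction_cutoff_mul (H := fun ζ => density β ζ * inner ℝ (steering β ζ) (b i))
      hβ (by positivity) hz₀ hχ hε hχε hχR
      (fun ζ h => contDiffAt_density_mul_steering _ h)
      (fun ζ h hne => hcone ζ h (left_ne_zero_of_mul hne))
  have hφ0 : ∀ z, 0 ≤ φ z := by
    intro z
    by_cases h0 : χ (relCoord z₀ z).1 = 0
    · simp [hφdef, h0]
    · refine mul_nonneg (hχ0 _) (density_nonneg ?_)
      by_contra hcon; exact h0 (hχε _ ((not_le.mp hcon).trans hε))
  have hmain := hsub φ hφ hφ0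
  have i1 : Integrable (fun z => f z * transport φ z) (halfMeasure d T) :=
    hf.integrable_mul_of_hasCompactSupport hp₁ hφ.continuous_transport
      hφ.hasCompactSupport_transport
  have i2 : ∀ i, Integrable (fun z => f z * velDeriv (ψ i) z (b i)) (halfMeasure d T) := fun i =>
    hf.integrable_mul_of_hasCompactSupport hp₁ ((hψ i).continuous_velDeriv _)
      ((hψ i).hasCompactSupport_velDeriv _)
  have i3 := hφ.integrable_velDeriv hS₀ hp₃
  have i4 : Integrable (fun z => S₁ z * φ z) (halfMeasure d T) :=
    hS₁.integrable_mul_of_hasCompactSupport hp₄ hφ.smooth.continuous hφ.compact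
  have i5 : ∀ i, Integrable (fun z => inner ℝ (G z) (b i) * ψ i z) (halfMeasure d T) := fun i =>
    (hG.inner_const (b i)).integrable_mul_of_hasCompactSupport hp₂ (hψ i).smooth.continuous
      (hψ i).compact
  have hpt : ∀ z, f z * (deriv χ (relCoord z₀ z).1 * density β (relCoord z₀ z))
      = -(f z * transport φ z) + ∑ i, f z * velDeriv (ψ i) z (b i) := by
    intro z
    have := transport_cutoff_density (β := β) hχ hε hχε (z₀ := z₀) z
    rw [← Finset.mul_sum]
    linear_combination (-f z) * this
  have i2s : Integrable (fun z => ∑ i, f z * velDeriv (ψ i) z (b i)) (halfMeasure d T) :=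
    integrable_finsetSum _ fun i _ => i2 i
  have i5s : Integrable (fun z => ∑ i, inner ℝ (G z) (b i) * ψ i z) (halfMeasure d T) :=
    integrable_finsetSum _ fun i _ => i5 i
  -- Weak integration by parts, one coordinate of the field χ ρ u at a time.
  have e1 : ∫ z, ∑ i, f z * velDeriv (ψ i) z (b i) ∂(halfMeasure d T)
      = -∫ z, ∑ i, inner ℝ (G z) (b i) * ψ i z ∂(halfMeasure d T) := by
    rw [integral_finsetSum _ fun i _ => i2 i, integral_finsetSum _ fun i _ => i5 i,
      ← Finset.sum_neg_distrib]
    exact Finset.sum_congr rfl fun i _ => hfG (ψ i) (hψ i) (b i)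
  have e2 : ∀ z, χ (relCoord z₀ z).1 * (S₁ z * density β (relCoord z₀ z)
          - density β (relCoord z₀ z) * inner ℝ (G z) (steering β (relCoord z₀ z))
          - fderiv ℝ (density β) (relCoord z₀ z) (0, 0, S₀ z))
      = S₁ z * φ z - ∑ i, inner ℝ (G z) (b i) * ψ i z - velDeriv φ z (S₀ z) := by
    intro z
    rw [hφdef, velDeriv_cutoff_mul hχ hε hχε (fun ζ h => contDiffAt_density h),
      ← b.sum_inner_mul_inner (G z), Finset.mul_sum, mul_sub, mul_sub, Finset.mul_sum]
    congr 2
    · ring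
    · refine Finset.sum_congr rfl fun i _ => ?_
      simp only [hψdef]
      rw [real_inner_comm (b i) (steering β _)]
      ring
  have i1n : Integrable (fun z => -(f z * transport φ z)) (halfMeasure d T) := i1.neg
  have i13 : Integrable (fun z => -(f z * transport φ z) + velDeriv φ z (S₀ z))
    (halfMeasure d T) := i1n.add i3
  have i45 : Integrable (fun z => S₁ z * φ z - ∑ i, inner ℝ (G z) (b i) * ψ i z)
    (halfMeasure d T) := i4.sub i5s
  simp_rw [hpt, e2]
  rw [integral_add i1n i2s, e1, integral_sub i45 i3, integral_sub i4 i5s]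
  rw [integral_sub i13 i4, integral_add i1n i3] at hmain
  linarith

end Representation

/-! ### Kinetic potentials of the data -/

section Potential

variable {d : ℕ} {β T : ℝ}

/-- The sum of the kinetic potentials of the velocity gradient and of the source terms. -/
noncomputable def kineticPotential (β T : ℝ) (G S₀ : Phase d → Vel d) (S₁ : Phase d → ℝ)
    (z₀ : Phase d) : ℝ≥0∞ :=
  ∫⁻ z, kineticKernel β (2 + β) (d * (1 + 2 * β) + 1 - β) (z₀, z) * ‖G z‖ₑ ∂(halfMeasure d T)
  + ∫⁻ z, kineticKernel β (2 + β) (d * (1 + 2 * β) + β) (z₀, z) * ‖S₀ z‖ₑ ∂(halfMeasure d T)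
  + ∫⁻ z, kineticKernel β (2 + β) (d * (1 + 2 * β)) (z₀, z) * ‖S₁ z‖ₑ ∂(halfMeasure d T)

/-- Representation inequality: the average of a weak subsolution against the time derivative of a
cutoff of the self-similar density is bounded by the kinetic potentials of the data. -/
theorem exists_ofReal_integral_deriv_cutoff_le (d : ℕ) (hβ : 0 < β) :
    ∃ C : ℝ, 0 < C ∧ ∀ (T ε R : ℝ) (χ : ℝ → ℝ) (z₀ : Phase d), ContDiff ℝ ∞ χ → 0 < ε →
      (∀ τ, τ < ε → χ τ = 0) → (∀ τ, R < τ → χ τ = 0) → (∀ τ, 0 ≤ χ τ) → (∀ τ, χ τ ≤ 1) →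
      z₀.1 < T → ∀ (f S₁ : Phase d → ℝ) (G S₀ : Phase d → Vel d) (p₁ p₂ p₃ p₄ : ℝ≥0∞),
      1 ≤ p₁ → 1 ≤ p₂ → 1 ≤ p₃ → 1 ≤ p₄ →
      MemLp f p₁ (halfMeasure d T) → MemLp G p₂ (halfMeasure d T) →
      MemLp S₀ p₃ (halfMeasure d T) → MemLp S₁ p₄ (halfMeasure d T) →
      IsWeakVelGrad T f G → IsWeakSubsolution T f S₀ S₁ →
      ENNReal.ofReal (∫ z, f z * (deriv χ (relCoord z₀ z).1 * density β (relCoord z₀ z))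
        ∂(halfMeasure d T)) ≤ ENNReal.ofReal C * kineticPotential β T G S₀ S₁ z₀ := by
  obtain ⟨C₁, hC₁, hC₁'⟩ := exists_deriv_smoothTransition_le
  set C₂ : ℝ := 2 + β + β * (2 + β) with hC₂
  have hC₂0 : 0 < C₂ := by positivity
  -- The summands bound ρ, ρ u and ∇_w ρ respectively, relative to their powers of τ.
  refine ⟨1 + C₂ + 2 * C₁, by positivity, ?_⟩
  intro T ε R χ z₀ hχ hε hχε hχR hχ0 hχ1 hz₀ f S₁ G S₀ p₁ p₂ p₃ p₄ hp₁ hp₂ hp₃ hp₄ hf hG hS₀ hS₁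
    hfG hsub
  set C : ℝ := 1 + C₂ + 2 * C₁ with hC
  have hint := integral_deriv_cutoff_le (β := β) hχ hε hχε hβ hz₀ hχ0 hχR hp₁ hp₂ hp₃ hp₄
    hf hG hS₀ hS₁ hfG hsub
  refine (ENNReal.ofReal_le_ofReal (hint.trans (le_abs_self _))).trans ?_
  rw [← Real.enorm_eq_ofReal_abs]
  refine (enorm_integral_le_lintegral_enorm _).trans ?_
  have hmk : ∀ m, Measurable fun z => kineticKernel (d := d) β (2 + β) m (z₀, z) := fun m =>
    (measurable_kineticKernel β (2 + β) m).comp measurable_prodMk_left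
  have m1 : AEMeasurable (fun z => kineticKernel β (2 + β) (d * (1 + 2 * β) + 1 - β) (z₀, z)
    * ‖G z‖ₑ) (halfMeasure d T) := (hmk _).aemeasurable.mul hG.1.enorm
  have m2 : AEMeasurable (fun z => kineticKernel β (2 + β) (d * (1 + 2 * β) + 1 - β) (z₀, z)
    * ‖G z‖ₑ + kineticKernel β (2 + β) (d * (1 + 2 * β) + β) (z₀, z) * ‖S₀ z‖ₑ)
    (halfMeasure d T) := m1.add ((hmk _).aemeasurable.mul hS₀.1.enorm)
  rw [kineticPotential, ← lintegral_add_left' m1, ← lintegral_add_left' m2,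
    ← lintegral_const_mul' _ _ ENNReal.ofReal_ne_top]
  refine lintegral_mono fun z => ?_
  set ζ := relCoord z₀ z with hζ
  by_cases h0 : χ ζ.1 = 0
  · simp [h0]
  have h : 0 < ζ.1 := by
    by_contra hcon; exact h0 (hχε _ (lt_of_le_of_lt (not_lt.mp hcon) hε))
  rcases lt_or_ge 1 (energy β ζ) with hE | hE
  · have hd : density β ζ = 0 := by
      by_contra hne; exact absurd (energy_le_of_density_ne_zero hne) (not_le.mpr hE)
    simp [hd, fderiv_density_vel_eq_zero h hE]
  have hmem := mem_kineticCone_of_energy_le hβ h hE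
  rw [kineticKernel_eq hmem, kineticKernel_eq hmem, kineticKernel_eq hmem]
  have hτ : z₀.1 - z.1 = ζ.1 := rfl
  rw [hτ, ← ofReal_norm, ← ofReal_norm, ← ofReal_norm, ← ofReal_norm,
    ← ENNReal.ofReal_mul (by positivity), ← ENNReal.ofReal_mul (by positivity),
    ← ENNReal.ofReal_mul (by positivity), ← ENNReal.ofReal_add (by positivity) (by positivity),
    ← ENNReal.ofReal_add (by positivity) (by positivity), ← ENNReal.ofReal_mul (by positivity)]
  refine ENNReal.ofReal_le_ofReal ?_
  set N : ℝ := d * (1 + 2 * β) with hN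
  have hρ0 : 0 ≤ density β ζ := density_nonneg h.le
  have hρ : density β ζ ≤ ζ.1 ^ (-N) := density_le h.le
  have hu := norm_steering_le hβ h hE
  have t1 : |density β ζ * inner ℝ (G z) (steering β ζ)|
      ≤ C₂ * (ζ.1 ^ (-(N + 1 - β)) * ‖G z‖) := by
    rw [abs_mul, abs_of_nonneg hρ0]
    calc density β ζ * |inner ℝ (G z) (steering β ζ)|
        ≤ ζ.1 ^ (-N) * (‖G z‖ * (C₂ * ζ.1 ^ (β - 1))) := by
          gcongr
          exact (abs_real_inner_le_norm _ _).trans (by gcongr)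
      _ = _ := by
          rw [show -(N + 1 - β) = -N + (β - 1) by ring, Real.rpow_add h]; ring
  have t2 : |fderiv ℝ (density β) ζ (0, 0, S₀ z)| ≤ 2 * C₁ * (ζ.1 ^ (-(N + β)) * ‖S₀ z‖) :=
    (abs_fderiv_density_vel_le hC₁' h hE (S₀ z)).trans (le_of_eq (by ring))
  have t3 : |S₁ z * density β ζ| ≤ ζ.1 ^ (-N) * ‖S₁ z‖ := by
    rw [abs_mul, abs_of_nonneg hρ0, mul_comm, Real.norm_eq_abs]
    gcongr
  rw [norm_mul, Real.norm_of_nonneg (hχ0 _), Real.norm_eq_abs]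
  have p1 : 0 ≤ ζ.1 ^ (-(N + 1 - β)) * ‖G z‖ := by positivity
  have p2 : 0 ≤ ζ.1 ^ (-(N + β)) * ‖S₀ z‖ := by positivity
  have p3 : 0 ≤ ζ.1 ^ (-N) * ‖S₁ z‖ := by positivity
  refine (mul_le_of_le_one_left (abs_nonneg _) (hχ1 _)).trans ?_
  refine (abs_sub _ _).trans ((add_le_add_left (abs_sub _ _) _).trans ?_)
  have q1 : C₂ * (ζ.1 ^ (-(N + 1 - β)) * ‖G z‖) ≤ C * (ζ.1 ^ (-(N + 1 - β)) * ‖G z‖) := by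
    gcongr; rw [hC]; linarith
  have q2 : 2 * C₁ * (ζ.1 ^ (-(N + β)) * ‖S₀ z‖) ≤ C * (ζ.1 ^ (-(N + β)) * ‖S₀ z‖) := by
    gcongr; rw [hC]; linarith
  have q3 : 1 * (ζ.1 ^ (-N) * ‖S₁ z‖) ≤ C * (ζ.1 ^ (-N) * ‖S₁ z‖) := by
    gcongr; rw [hC]; linarith
  linarith

end Potential

/-! ### Galilean maps preserve Lebesgue measure -/

section GalileanMaps

variable {d : ℕ}

/-- A skew product: reflection in time, then a translation in (x, v) depending only on the lag. -/
theorem measurePreserving_galShift (z₀ : Phase d) :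
    MeasurePreserving (galShift z₀) volume volume := by
  have h := (Measure.measurePreserving_sub_left (volume : Measure ℝ) z₀.1).skew_product
    (μc := (volume : Measure (Vel d)).prod volume) (μd := (volume : Measure (Vel d)).prod volume)
    (g := fun t y => (z₀.2.1 - t • z₀.2.2, z₀.2.2) + y)
    (by unfold Function.uncurry; fun_prop)
    (ae_of_all _ fun t => (measurePreserving_add_left _ _).map_eq)
  exact h

theorem measurable_relCoord (z₀ : Phase d) : Measurable (relCoord z₀) :=
  (continuous_relCoord.comp (Continuous.prodMk_right z₀)).measurable

theorem lintegral_comp_relCoord (z₀ : Phase d) {F : Phase d → ℝ≥0∞} (hF : Measurable F) :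
    ∫⁻ z, F (relCoord z₀ z) = ∫⁻ ζ, F ζ := by
  have hm : Measurable fun z => F (relCoord z₀ z) := hF.comp (measurable_relCoord z₀)
  rw [← (measurePreserving_galShift z₀).lintegral_comp hm]
  simp_rw [relCoord_galShift]

/-- With ζ fixed, v is translated and x undergoes a shear driven by v. The two swaps place v first,
as the base of the skew product. -/
theorem measurePreserving_galShift_left (ζ : Phase d) :
    MeasurePreserving (fun z₀ => galShift z₀ ζ) volume volume := by
  have h1 := (measurePreserving_add_right (volume : Measure (Vel d)) ζ.2.2).skew_product
    (μc := (volume : Measure (Vel d))) (μd := (volume : Measure (Vel d)))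
    (g := fun v x => -(ζ.1 • v) + ζ.2.1 + x) (by unfold Function.uncurry; fun_prop)
    (ae_of_all _ fun v => (measurePreserving_add_left _ _).map_eq)
  have hs := Measure.measurePreserving_swap (μ := (volume : Measure (Vel d)))
    (ν := (volume : Measure (Vel d)))
  have h3 := (measurePreserving_sub_right (volume : Measure ℝ) ζ.1).prod ((hs.comp h1).comp hs)
  refine (congrArg (fun F => MeasurePreserving F volume volume) (funext fun z => ?_)).mp h3
  simp only [galShift, Prod.map, Function.comp_apply, Prod.swap, Prod.mk.injEq, true_and, and_true]
  abel

end GalileanMaps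

/-! ### Shells of the density and their mass -/

section Shell

variable {d : ℕ} {β ε : ℝ}

/-- The smooth step rising from `0` to `1` on `[ε, 2ε]`. -/
noncomputable def timeStep (ε τ : ℝ) : ℝ := Real.smoothTransition (τ / ε - 1)

theorem contDiff_timeStep (ε : ℝ) : ContDiff ℝ ∞ (timeStep ε) :=
  Real.smoothTransition.contDiff.comp ((contDiff_id.div_const ε).sub contDiff_const)

theorem deriv_timeStep (ε τ : ℝ) :
    deriv (timeStep ε) τ = deriv Real.smoothTransition (τ / ε - 1) / ε := by
  have h1 : HasDerivAt (fun τ : ℝ => τ / ε - 1) (1 / ε) τ :=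
    ((hasDerivAt_id τ).div_const ε).sub_const 1
  have h2 := (differentiable_smoothTransition (τ / ε - 1)).hasDerivAt
  have h3 : HasDerivAt (timeStep ε) _ τ := h2.comp τ h1
  rw [h3.deriv]; ring

theorem contDiff_deriv_timeStep (ε : ℝ) : ContDiff ℝ ∞ (deriv (timeStep ε)) :=
  (contDiff_infty_iff_deriv.mp (contDiff_timeStep ε)).2

theorem deriv_timeStep_nonneg (hε : 0 < ε) (τ : ℝ) : 0 ≤ deriv (timeStep ε) τ := by
  rw [deriv_timeStep]; exact div_nonneg (deriv_smoothTransition_nonneg _) hε.le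

theorem deriv_timeStep_of_lt (hε : 0 < ε) {τ : ℝ} (h : τ < ε) : deriv (timeStep ε) τ = 0 := by
  rw [deriv_timeStep, deriv_smoothTransition_of_neg, zero_div]
  rw [sub_neg, div_lt_one hε]; exact h

theorem deriv_timeStep_of_gt (hε : 0 < ε) {τ : ℝ} (h : 2 * ε < τ) : deriv (timeStep ε) τ = 0 := by
  rw [deriv_timeStep, deriv_smoothTransition_of_one_lt, zero_div]
  rw [lt_sub_iff_add_lt, lt_div_iff₀ hε]; linarith

theorem timeStep_of_le (hε : 0 < ε) {τ : ℝ} (h : τ ≤ ε) : timeStep ε τ = 0 := by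
  refine Real.smoothTransition.zero_of_nonpos ?_
  rw [sub_nonpos, div_le_one hε]; exact h

theorem timeStep_of_ge (hε : 0 < ε) {τ : ℝ} (h : 2 * ε ≤ τ) : timeStep ε τ = 1 := by
  refine Real.smoothTransition.one_of_one_le ?_
  rw [le_sub_iff_add_le, le_div_iff₀ hε]; linarith

theorem lintegral_deriv_timeStep (hε : 0 < ε) :
    ∫⁻ τ, ENNReal.ofReal (deriv (timeStep ε) τ) = 1 := by
  have hc : Continuous (deriv (timeStep ε)) := (contDiff_deriv_timeStep ε).continuous
  have hle : ε ≤ 2 * ε := by linarith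
  have h1 : ∫⁻ τ, ENNReal.ofReal (deriv (timeStep ε) τ)
      = ∫⁻ τ in Icc ε (2 * ε), ENNReal.ofReal (deriv (timeStep ε) τ) := by
    rw [← lintegral_indicator measurableSet_Icc]
    refine lintegral_congr fun τ => ?_
    by_cases h : τ ∈ Icc ε (2 * ε)
    · rw [indicator_of_mem h]
    · rw [indicator_of_notMem h]
      rcases lt_or_ge τ ε with h' | h'
      · rw [deriv_timeStep_of_lt hε h', ENNReal.ofReal_zero]
      · rw [deriv_timeStep_of_gt hε (by by_contra hcon; exact h ⟨h', not_lt.mp hcon⟩),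
          ENNReal.ofReal_zero]
  rw [h1, ← ofReal_integral_eq_lintegral_ofReal
    (hc.continuousOn.integrableOn_Icc) (ae_of_all _ fun τ => deriv_timeStep_nonneg hε τ),
    integral_Icc_eq_integral_Ioc, ← intervalIntegral.integral_of_le hle,
    intervalIntegral.integral_deriv_eq_sub
      (fun τ _ => (contDiff_timeStep ε).differentiable (by simp) τ) (hc.intervalIntegrable _ _),
    timeStep_of_ge hε le_rfl, timeStep_of_le hε le_rfl]
  simp

/-- The density restricted smoothly to time lags in `[ε, 2ε]`. -/
noncomputable def shell (β ε : ℝ) (ζ : Phase d) : ℝ := deriv (timeStep ε) ζ.1 * density β ζ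

theorem measurable_density (β : ℝ) : Measurable (density (d := d) β) := by
  have h1 : Measurable (posVar (d := d) β) := by unfold posVar; fun_prop
  have h2 : Measurable (velVar (d := d) β) := by unfold velVar; fun_prop
  have h3 : Measurable (energy (d := d) β) := by unfold energy; fun_prop
  have h4 : Measurable fun ζ : Phase d => Real.smoothTransition (1 - energy β ζ) :=
    Real.smoothTransition.continuous.measurable.comp (by fun_prop)
  unfold density
  fun_prop

theorem measurable_shell (β ε : ℝ) : Measurable (shell (d := d) β ε) :=
  ((contDiff_deriv_timeStep ε).continuous.measurable.comp measurable_fst).mul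
    (measurable_density β)

theorem shell_nonneg (hε : 0 < ε) (ζ : Phase d) : 0 ≤ shell β ε ζ := by
  rcases lt_or_ge ζ.1 ε with h | h
  · rw [shell, deriv_timeStep_of_lt hε h, zero_mul]
  · exact mul_nonneg (deriv_timeStep_nonneg hε _) (density_nonneg (hε.le.trans h))

theorem of_shell_ne_zero (hβ : 0 < β) (hε : 0 < ε) {ζ : Phase d} (h : shell β ε ζ ≠ 0) :
    ε ≤ ζ.1 ∧ ζ.1 ≤ 2 * ε ∧ ζ ∈ kineticCone d β (2 + β) := by
  have h1 : ε ≤ ζ.1 := by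
    by_contra hcon
    exact h (by rw [shell, deriv_timeStep_of_lt hε (not_le.mp hcon), zero_mul])
  refine ⟨h1, ?_, mem_kineticCone_of_energy_le hβ (hε.trans_le h1)
    (energy_le_of_density_ne_zero (right_ne_zero_of_mul h))⟩
  by_contra hcon
  exact h (by rw [shell, deriv_timeStep_of_gt hε (not_le.mp hcon), zero_mul])

theorem shell_le {C : ℝ} (hC : ∀ x, deriv Real.smoothTransition x ≤ C) (hβ : 0 < β) (hε : 0 < ε)
    (ζ : Phase d) : shell β ε ζ ≤ C / ε * ε ^ (-(d * (1 + 2 * β))) := by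
  have hC0 : 0 ≤ C := (deriv_smoothTransition_nonneg 0).trans (hC 0)
  rcases lt_or_ge ζ.1 ε with h | h
  · rw [shell, deriv_timeStep_of_lt hε h, zero_mul]; positivity
  · rw [shell, deriv_timeStep]
    have h0 : 0 < ζ.1 := hε.trans_le h
    have h1 : density β ζ ≤ ε ^ (-(d * (1 + 2 * β))) := (density_le h0.le).trans
      (Real.rpow_le_rpow_of_nonpos hε h (by rw [neg_nonpos]; positivity))
    have := deriv_smoothTransition_nonneg (ζ.1 / ε - 1)
    have := density_nonneg (β := β) h0.le
    gcongr
    exact hC _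

theorem isTestFunction_shell {T : ℝ} (hβ : 0 < β) (hε : 0 < ε) {z₀ : Phase d} (hz₀ : z₀.1 < T) :
    IsTestFunction (halfSpace d T) fun z => shell β ε (relCoord z₀ z) :=
  isTestFunction_cutoff_mul hβ (by positivity : 0 ≤ 2 + β) hz₀ (contDiff_deriv_timeStep ε) hε
    (fun _ h => deriv_timeStep_of_lt hε h) (fun _ h => deriv_timeStep_of_gt hε h)
    (fun _ h => contDiffAt_density h)
    (fun _ h hne => mem_kineticCone_of_energy_le hβ h (energy_le_of_density_ne_zero hne))

/-- The total mass of a time slice of the density. -/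
noncomputable def sliceMass (d : ℕ) : ℝ≥0∞ :=
  ∫⁻ x : Vel d, ∫⁻ v : Vel d, ENNReal.ofReal (Real.smoothTransition (1 - (‖x‖ ^ 2 + ‖v‖ ^ 2)))

theorem lintegral_comp_smul_add {F : Vel d → ℝ≥0∞} (hF : Measurable F) {r : ℝ} (hr : 0 < r)
    (c : Vel d) :
    ∫⁻ x, F (r • x + c) = ENNReal.ofReal (r ^ (-(d : ℝ))) * ∫⁻ x, F x := by
  have hFc : Measurable fun x => F (x + c) := by fun_prop
  have h1 := lintegral_map (μ := volume) hFc (measurable_const_smul r)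
  rw [Measure.map_addHaar_smul _ hr.ne', lintegral_smul_measure, lintegral_add_right_eq_self] at h1
  rw [← h1, smul_eq_mul]
  congr 2
  rw [abs_of_nonneg (by positivity), Real.rpow_neg hr.le, Real.rpow_natCast]
  simp

/-- Rescaling w to W at fixed y, then y to X, produces τ ^ (β d) and τ ^ ((1 + β) d), which cancel
the prefactor τ ^ (-(d (1 + 2β))); the slice mass does not depend on τ. -/
theorem lintegral_density_slice (β : ℝ) {τ : ℝ} (hτ : 0 < τ) :
    ∫⁻ y : Vel d × Vel d, ENNReal.ofReal (density β (τ, y)) = sliceMass d := by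
  have hm : Measurable fun y : Vel d × Vel d => ENNReal.ofReal (density β (τ, y)) :=
    ((measurable_density β).comp measurable_prodMk_left).ennreal_ofReal
  have e1 : ∫⁻ y : Vel d × Vel d, ENNReal.ofReal (density β (τ, y))
      = ∫⁻ x : Vel d, ∫⁻ v : Vel d, ENNReal.ofReal (density β (τ, x, v)) :=
    lintegral_prod _ hm.aemeasurable
  have hst : Measurable Real.smoothTransition := Real.smoothTransition.continuous.measurable
  have e2 : ∀ x : Vel d, ∫⁻ v : Vel d, ENNReal.ofReal (density β (τ, x, v))
      = ENNReal.ofReal (τ ^ (-(d * (1 + 2 * β)))) * (ENNReal.ofReal ((τ ^ (-β)) ^ (-(d : ℝ))) *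
        ∫⁻ v : Vel d, ENNReal.ofReal (Real.smoothTransition
          (1 - (‖τ ^ (-(1 + β)) • x + 0‖ ^ 2 + ‖v‖ ^ 2)))) := by
    intro x
    have hF : Measurable fun v : Vel d => ENNReal.ofReal (Real.smoothTransition
          (1 - (‖τ ^ (-(1 + β)) • x + 0‖ ^ 2 + ‖v‖ ^ 2))) := by fun_prop
    rw [← lintegral_comp_smul_add hF (Real.rpow_pos_of_pos hτ _)
      ((1 + β) • τ ^ (-(1 + β)) • x), ← lintegral_const_mul _ (by fun_prop)]
    refine lintegral_congr fun v => ?_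
    rw [← ENNReal.ofReal_mul (by positivity)]
    simp only [density, energy, velVar, posVar, add_zero]
  rw [e1]
  simp_rw [e2]
  have hG : Measurable fun x : Vel d => ∫⁻ v : Vel d, ENNReal.ofReal (Real.smoothTransition
      (1 - (‖x‖ ^ 2 + ‖v‖ ^ 2))) :=
    Measurable.lintegral_prod_right' (f := fun z : Vel d × Vel d => ENNReal.ofReal
      (Real.smoothTransition (1 - (‖z.1‖ ^ 2 + ‖z.2‖ ^ 2)))) (by fun_prop)
  have hG' : Measurable fun x : Vel d => ∫⁻ v : Vel d, ENNReal.ofReal (Real.smoothTransition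
      (1 - (‖τ ^ (-(1 + β)) • x + 0‖ ^ 2 + ‖v‖ ^ 2))) :=
    hG.comp (g := fun x => ∫⁻ v : Vel d, ENNReal.ofReal (Real.smoothTransition
      (1 - (‖x‖ ^ 2 + ‖v‖ ^ 2)))) ((measurable_const_smul (τ ^ (-(1 + β)))).add_const 0)
  rw [lintegral_const_mul _ (hG'.const_mul _), lintegral_const_mul _ hG',
    lintegral_comp_smul_add hG (Real.rpow_pos_of_pos hτ _) 0, ← mul_assoc, ← mul_assoc,
    ← ENNReal.ofReal_mul (by positivity), ← ENNReal.ofReal_mul (by positivity),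
    ← Real.rpow_mul hτ.le, ← Real.rpow_mul hτ.le, ← Real.rpow_add hτ, ← Real.rpow_add hτ,
    show -(d * (1 + 2 * β)) + -β * -(d : ℝ) + -(1 + β) * -(d : ℝ) = 0 by ring, Real.rpow_zero,
    ENNReal.ofReal_one, one_mul, sliceMass]

/-- The time profile has integral 1 and the slices have equal mass, so the total is independent of
ε: the shells form an approximate identity up to the factor `sliceMass d`. -/
theorem lintegral_shell (hε : 0 < ε) :
    ∫⁻ ζ : Phase d, ENNReal.ofReal (shell β ε ζ) = sliceMass d := by
  have e1 : ∫⁻ ζ : Phase d, ENNReal.ofReal (shell β ε ζ)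
      = ∫⁻ τ, ∫⁻ y : Vel d × Vel d, ENNReal.ofReal (shell β ε (τ, y)) :=
    lintegral_prod _ (measurable_shell β ε).ennreal_ofReal.aemeasurable
  have e2 : ∀ τ, ∫⁻ y : Vel d × Vel d, ENNReal.ofReal (shell β ε (τ, y))
      = ENNReal.ofReal (deriv (timeStep ε) τ) * sliceMass d := by
    intro τ
    rcases lt_or_ge τ ε with h | h
    · simp [shell, deriv_timeStep_of_lt hε h]
    · rw [← lintegral_density_slice β (hε.trans_le h), ← lintegral_const_mul]
      · refine lintegral_congr fun y => ?_
        rw [shell, ENNReal.ofReal_mul (deriv_timeStep_nonneg hε _)]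
      · exact ((measurable_density β).comp measurable_prodMk_left).ennreal_ofReal
  rw [e1]
  simp_rw [e2]
  rw [lintegral_mul_const, lintegral_deriv_timeStep hε, one_mul]
  exact (contDiff_deriv_timeStep ε).continuous.measurable.ennreal_ofReal

theorem sliceMass_ne_top (d : ℕ) : sliceMass d ≠ ⊤ := by
  have hle : sliceMass d ≤ ∫⁻ x : Vel d, ∫⁻ v : Vel d,
      (Metric.closedBall (0 : Vel d) 1).indicator 1 x
        * (Metric.closedBall (0 : Vel d) 1).indicator 1 v := by
    refine lintegral_mono fun x => lintegral_mono fun v => ?_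
    by_cases h : ‖x‖ ^ 2 + ‖v‖ ^ 2 ≤ 1
    · have hx : x ∈ Metric.closedBall (0 : Vel d) 1 := by
        rw [mem_closedBall_zero_iff]; nlinarith [norm_nonneg x, sq_nonneg ‖v‖]
      have hv : v ∈ Metric.closedBall (0 : Vel d) 1 := by
        rw [mem_closedBall_zero_iff]; nlinarith [norm_nonneg v, sq_nonneg ‖x‖]
      rw [indicator_of_mem hx, indicator_of_mem hv]
      simpa using Real.smoothTransition.le_one _
    · rw [Real.smoothTransition.zero_of_nonpos (by linarith)]
      simp
  refine (hle.trans_lt ?_).ne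
  have hm : Measurable ((Metric.closedBall (0 : Vel d) 1).indicator (1 : Vel d → ℝ≥0∞)) :=
    measurable_one.indicator measurableSet_closedBall
  simp_rw [lintegral_const_mul _ hm]
  rw [lintegral_mul_const _ hm, lintegral_indicator_one measurableSet_closedBall]
  exact ENNReal.mul_lt_top measure_closedBall_lt_top measure_closedBall_lt_top

theorem sliceMass_ne_zero (d : ℕ) : sliceMass d ≠ 0 := by
  have hm : Measurable fun z : Vel d × Vel d => ENNReal.ofReal
      (Real.smoothTransition (1 - (‖z.1‖ ^ 2 + ‖z.2‖ ^ 2))) := by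
    have := Real.smoothTransition.continuous.measurable
    fun_prop
  have e : sliceMass d = ∫⁻ z : Vel d × Vel d, ENNReal.ofReal
      (Real.smoothTransition (1 - (‖z.1‖ ^ 2 + ‖z.2‖ ^ 2))) :=
    (lintegral_prod _ hm.aemeasurable).symm
  rw [e, ← pos_iff_ne_zero, lintegral_pos_iff_support hm]
  have hopen : IsOpen {z : Vel d × Vel d | ‖z.1‖ ^ 2 + ‖z.2‖ ^ 2 < 1} :=
    isOpen_lt (by fun_prop) continuous_const
  refine lt_of_lt_of_le (hopen.measure_pos volume ⟨0, by simp⟩) (measure_mono fun z hz => ?_)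
  have : 0 < Real.smoothTransition (1 - (‖z.1‖ ^ 2 + ‖z.2‖ ^ 2)) :=
    Real.smoothTransition.pos_of_pos (by linarith [show ‖z.1‖ ^ 2 + ‖z.2‖ ^ 2 < 1 from hz])
  simpa using this

end Shell

/-! ### Recovering the function from its shell averages -/

section ApproximateIdentity

variable {d : ℕ} {β : ℝ}

/-- Translations along Galilean shifts are continuous in `L¹`. -/
theorem tendsto_lintegral_galShift_sub {g : Phase d → ℝ} (hg : Integrable g) :
    Tendsto (fun ζ => ∫⁻ z₀, ‖g (galShift z₀ ζ) - g z₀‖ₑ) (𝓝 0) (𝓝 0) := by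
  have hL : MemLp g 1 volume := memLp_one_iff_integrable.mpr hg
  let Φ : Phase d → C(Phase d, Phase d) := fun ζ =>
    ⟨fun z₀ => galShift z₀ ζ, continuous_galShift.comp (Continuous.prodMk_left ζ)⟩
  have hΦ : Continuous Φ := ContinuousMap.continuous_of_continuous_uncurry _
    (continuous_galShift.comp continuous_swap)
  have hmp : ∀ ζ, MeasurePreserving (Φ ζ) volume volume := measurePreserving_galShift_left
  -- Composition with a continuous family of measure-preserving maps is continuous in L¹; this
  -- replaces the usual continuity of translations, since the shift here is not a Euclidean one.
  have hcont : Continuous fun ζ => Lp.compMeasurePreserving (Φ ζ) (hmp ζ) (hL.toLp g) :=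
    continuous_const.compMeasurePreservingLp hΦ hmp ENNReal.one_ne_top
  have hed : Tendsto (fun ζ => edist (Lp.compMeasurePreserving (Φ ζ) (hmp ζ) (hL.toLp g))
      (Lp.compMeasurePreserving (Φ 0) (hmp 0) (hL.toLp g))) (𝓝 0) (𝓝 0) := by
    have := (hcont.edist (continuous_const (y := Lp.compMeasurePreserving (Φ 0) (hmp 0)
      (hL.toLp g)))).tendsto 0
    simpa using this
  refine hed.congr fun ζ => ?_
  rw [Lp.toLp_compMeasurePreserving, Lp.toLp_compMeasurePreserving, Lp.edist_toLp_toLp,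
    eLpNorm_one_eq_lintegral_enorm]
  refine lintegral_congr fun z₀ => ?_
  have h0 : galShift z₀ 0 = z₀ := by simp [galShift]
  simp [Φ, h0]

/-- Both cone radii, at lags up to 2ε, tend to 0 because β and 1 + β are positive. -/
theorem eventually_shell_support (hβ : 0 < β) {U : Set (Phase d)} (hU : U ∈ 𝓝 0) :
    ∀ᶠ ε in 𝓝[>] (0 : ℝ), ∀ ζ : Phase d, shell β ε ζ ≠ 0 → ζ ∈ U := by
  obtain ⟨r, hr, hrU⟩ := Metric.mem_nhds_iff.mp hU
  have t0 : Tendsto (fun ε : ℝ => 2 * ε) (𝓝[>] 0) (𝓝 0) := by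
    have : Tendsto (fun ε : ℝ => 2 * ε) (𝓝 0) (𝓝 (2 * 0)) := (continuous_const_mul 2).tendsto 0
    rw [mul_zero] at this
    exact this.mono_left nhdsWithin_le_nhds
  have t1 : ∀ a : ℝ, 0 < a →
      Tendsto (fun ε : ℝ => (2 + β) * (2 * ε) ^ a) (𝓝[>] 0) (𝓝 0) := by
    intro a ha
    have h1 := (Real.continuousAt_rpow_const 0 a (Or.inr ha.le)).tendsto.comp t0
    rw [Real.zero_rpow ha.ne'] at h1
    simpa using h1.const_mul (2 + β)
  filter_upwards [t0.eventually_lt_const hr, (t1 (1 + β) (by positivity)).eventually_lt_const hr,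
    (t1 β hβ).eventually_lt_const hr, self_mem_nhdsWithin] with ε h1 h2 h3 hε ζ hζ
  obtain ⟨h4, h5, h6, h7, h8⟩ := of_shell_ne_zero hβ hε hζ
  refine hrU ?_
  rw [mem_ball_zero_iff, Prod.norm_def, Prod.norm_def, max_lt_iff, max_lt_iff,
    Real.norm_of_nonneg h6.le]
  refine ⟨by linarith, h7.trans_lt (lt_of_le_of_lt (by gcongr) h2),
    h8.trans_lt (lt_of_le_of_lt (by gcongr) h3)⟩

/-- A function dominating all shell averages of an integrable function dominates the function. -/
theorem sliceMass_mul_enorm_le_of_shell_le (hβ : 0 < β) {g : Phase d → ℝ} (hgm : Measurable g)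
    (hg : Integrable g) {s : Set (Phase d)} {F : Phase d → ℝ≥0∞}
    (hF : ∀ z₀ ∈ s, ∀ ε, 0 < ε →
      ∫⁻ ζ, ENNReal.ofReal (shell β ε ζ) * ‖g (galShift z₀ ζ)‖ₑ ≤ F z₀) :
    ∀ᵐ z₀, z₀ ∈ s → sliceMass d * ‖g z₀‖ₑ ≤ F z₀ := by
  set D : ℝ → Phase d → ℝ≥0∞ := fun ε z₀ =>
    ∫⁻ ζ, ENNReal.ofReal (shell β ε ζ) * ‖g (galShift z₀ ζ) - g z₀‖ₑ with hD
  have hsm : ∀ ε, Measurable fun ζ : Phase d => ENNReal.ofReal (shell β ε ζ) := fun ε =>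
    (measurable_shell β ε).ennreal_ofReal
  have hgs : Measurable fun z : Phase d × Phase d => g (galShift z.1 z.2) :=
    hgm.comp continuous_galShift.measurable
  have hjoint : ∀ ε, Measurable fun z : Phase d × Phase d =>
      ENNReal.ofReal (shell β ε z.2) * ‖g (galShift z.1 z.2) - g z.1‖ₑ := fun ε =>
    ((hsm ε).comp measurable_snd).mul (hgs.sub (hgm.comp measurable_fst)).enorm
  have hDm : ∀ ε, Measurable (D ε) := fun ε => (hjoint ε).lintegral_prod_right'
  have hDint : ∀ ε, ∫⁻ z₀, D ε z₀ = ∫⁻ ζ, ENNReal.ofReal (shell β ε ζ) *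
      ∫⁻ z₀, ‖g (galShift z₀ ζ) - g z₀‖ₑ := by
    intro ε
    rw [hD, lintegral_lintegral_swap (hjoint ε).aemeasurable]
    refine lintegral_congr fun ζ => ?_
    have hgz : Measurable fun z₀ => g (galShift z₀ ζ) := hgs.comp measurable_prodMk_right
    have hgd : Measurable fun z₀ => ‖g (galShift z₀ ζ) - g z₀‖ₑ := (hgz.sub hgm).enorm
    rw [lintegral_const_mul _ hgd]
  -- After Fubini the error is an average of L¹ translation errors over a shrinking support, with
  -- total weight independent of ε.
  have hDlim : Tendsto (fun ε => ∫⁻ z₀, D ε z₀) (𝓝[>] 0) (𝓝 0) := by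
    rw [ENNReal.tendsto_nhds_zero]
    intro δ hδ
    have hδ' : 0 < δ / sliceMass d := ENNReal.div_pos hδ.ne' (sliceMass_ne_top d)
    have hU := (tendsto_lintegral_galShift_sub hg).eventually_le_const hδ'
    filter_upwards [eventually_shell_support hβ hU, self_mem_nhdsWithin] with ε hε hε0
    rw [hDint]
    calc _ ≤ ∫⁻ ζ, ENNReal.ofReal (shell (d := d) β ε ζ) * (δ / sliceMass d) := by
          refine lintegral_mono fun ζ => ?_
          by_cases h : shell β ε ζ = 0
          · simp [h]
          · gcongr
            exact hε ζ h
      _ = sliceMass d * (δ / sliceMass d) := by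
          rw [lintegral_mul_const _ (hsm ε), lintegral_shell hε0]
      _ ≤ δ := ENNReal.mul_div_le
  set e : ℕ → ℝ := fun n => 1 / ((n : ℝ) + 1) with he
  have he0 : ∀ n, 0 < e n := fun n => by positivity
  have het : Tendsto e atTop (𝓝[>] 0) :=
    tendsto_nhdsWithin_iff.mpr ⟨tendsto_one_div_add_atTop_nhds_zero_nat,
      Eventually.of_forall fun n => he0 n⟩
  -- A vanishing lower limit almost everywhere is enough, because the hypothesis on F holds for
  -- every ε.
  have hfatou : ∫⁻ z₀, liminf (fun n => D (e n) z₀) atTop = 0 := by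
    refine le_antisymm ((lintegral_liminf_le fun n => hDm (e n)).trans ?_) zero_le
    exact (hDlim.comp het).liminf_eq.le
  rw [lintegral_eq_zero_iff (.liminf fun n => hDm (e n))] at hfatou
  filter_upwards [hfatou] with z₀ hz₀ hs
  have hgz : Measurable fun ζ => g (galShift z₀ ζ) := hgs.comp measurable_prodMk_left
  have hle : ∀ n, sliceMass d * ‖g z₀‖ₑ ≤ F z₀ + D (e n) z₀ := by
    intro n
    calc sliceMass d * ‖g z₀‖ₑ
        = ∫⁻ ζ, ENNReal.ofReal (shell (d := d) β (e n) ζ) * ‖g z₀‖ₑ := by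
          rw [lintegral_mul_const _ (hsm _), lintegral_shell (he0 n)]
      _ ≤ ∫⁻ ζ, (ENNReal.ofReal (shell β (e n) ζ) * ‖g (galShift z₀ ζ)‖ₑ
            + ENNReal.ofReal (shell β (e n) ζ) * ‖g (galShift z₀ ζ) - g z₀‖ₑ) := by
          refine lintegral_mono fun ζ => ?_
          rw [← mul_add]
          gcongr
          calc ‖g z₀‖ₑ = ‖g (galShift z₀ ζ) - (g (galShift z₀ ζ) - g z₀)‖ₑ := by
                rw [sub_sub_cancel]
            _ ≤ _ := enorm_sub_le
      _ ≤ F z₀ + D (e n) z₀ := by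
          have hm1 : Measurable fun ζ => ENNReal.ofReal (shell β (e n) ζ) *
            ‖g (galShift z₀ ζ)‖ₑ := (hsm _).mul hgz.enorm
          rw [lintegral_add_left hm1]
          gcongr
          exact hF z₀ hs (e n) (he0 n)
  have hlim : sliceMass d * ‖g z₀‖ₑ - F z₀ ≤ liminf (fun n => D (e n) z₀) atTop :=
    le_liminf_of_le (by isBoundedDefault)
      (Eventually.of_forall fun n => tsub_le_iff_left.mpr (hle n))
  rw [hz₀] at hlim
  exact tsub_eq_zero_iff_le.mp (le_antisymm hlim zero_le)

end ApproximateIdentity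

/-! ### Pointwise bound by kinetic potentials -/

section PointwiseBound

variable {d : ℕ} {β T : ℝ}

/-- Averages of an `L²` function over shells at large time lag vanish. -/
theorem tendsto_lintegral_shell_atTop (hβ : 0 < β) {f : Phase d → ℝ}
    (hf : MemLp f 2 (halfMeasure d T)) (z₀ : Phase d) :
    Tendsto (fun R => ∫⁻ z, ‖f z‖ₑ * ENNReal.ofReal (shell β R (relCoord z₀ z))
      ∂(halfMeasure d T)) atTop (𝓝 0) := by
  obtain ⟨C, hC, hC'⟩ := exists_deriv_smoothTransition_le
  set A : ℝ≥0∞ := (∫⁻ z, ‖f z‖ₑ ^ (2 : ℝ) ∂(halfMeasure d T)) ^ (1 / (2 : ℝ)) with hA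
  have hAt : A ≠ ⊤ := by
    have := hf.2
    rw [eLpNorm_eq_lintegral_rpow_enorm_toReal two_ne_zero ENNReal.ofNat_ne_top] at this
    simpa [hA] using this.ne
  have hsm : ∀ R, Measurable fun z => ENNReal.ofReal (shell (d := d) β R (relCoord z₀ z)) :=
    fun R => ((measurable_shell β R).comp (measurable_relCoord z₀)).ennreal_ofReal
  -- Cauchy–Schwarz: the squared L² norm of the shell is at most its supremum times its mass. The
  -- supremum is at most C / R, as the further factor R ^ (-(d (1 + 2β))) is at most 1 for R ≥ 1.
  have hbound : ∀ R : ℝ, 1 ≤ R → ∫⁻ z, ‖f z‖ₑ * ENNReal.ofReal (shell β R (relCoord z₀ z))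
      ∂(halfMeasure d T) ≤ A * (ENNReal.ofReal (C / R) * sliceMass d) ^ (1 / (2 : ℝ)) := by
    intro R hR
    have hR0 : 0 < R := by linarith
    refine (ENNReal.lintegral_mul_le_Lp_mul_Lq _ Real.HolderConjugate.two_two hf.1.enorm
      (hsm R).aemeasurable).trans ?_
    gcongr
    calc ∫⁻ z, ENNReal.ofReal (shell β R (relCoord z₀ z)) ^ (2 : ℝ) ∂(halfMeasure d T)
        ≤ ∫⁻ z, ENNReal.ofReal (shell (d := d) β R (relCoord z₀ z)) ^ (2 : ℝ) :=
          lintegral_mono' Measure.restrict_le_self le_rfl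
      _ ≤ ∫⁻ z, ENNReal.ofReal (C / R) * ENNReal.ofReal (shell (d := d) β R (relCoord z₀ z)) := by
          refine lintegral_mono fun z => ?_
          rw [ENNReal.rpow_two, sq]
          gcongr
          refine (shell_le hC' hβ hR0 _).trans (mul_le_of_le_one_right (by positivity) ?_)
          exact Real.rpow_le_one_of_one_le_of_nonpos hR (by rw [neg_nonpos]; positivity)
      _ = ENNReal.ofReal (C / R) * sliceMass d := by
          rw [lintegral_const_mul _ (hsm R),
            lintegral_comp_relCoord z₀ (measurable_shell β R).ennreal_ofReal, lintegral_shell hR0]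
  have hlim : Tendsto (fun R : ℝ => A * (ENNReal.ofReal (C / R) * sliceMass d) ^ (1 / (2 : ℝ)))
      atTop (𝓝 0) := by
    have h1 : Tendsto (fun R : ℝ => ENNReal.ofReal (C / R)) atTop (𝓝 0) := by
      have := ENNReal.tendsto_ofReal (tendsto_const_nhds.div_atTop tendsto_id :
        Tendsto (fun R : ℝ => C / R) atTop (𝓝 0))
      rwa [ENNReal.ofReal_zero] at this
    have h2 := ENNReal.Tendsto.mul_const h1 (Or.inr (sliceMass_ne_top d))
    rw [zero_mul] at h2
    have h3 := (ENNReal.continuous_rpow_const (y := 1 / (2 : ℝ))).tendsto 0 |>.comp h2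
    rw [ENNReal.zero_rpow_of_pos (by norm_num)] at h3
    have h4 := ENNReal.Tendsto.const_mul h3 (Or.inr hAt)
    rwa [mul_zero] at h4
  exact tendsto_of_tendsto_of_tendsto_of_le_of_le' tendsto_const_nhds hlim
    (Eventually.of_forall fun _ => zero_le)
    ((eventually_ge_atTop 1).mono hbound)

/-- Since 2ε ≤ R, the first step has reached 1 before the second leaves 0, so the product rule
leaves no mixed terms. -/
theorem deriv_timeStep_mul_one_sub {ε R : ℝ} (hε : 0 < ε) (hR : 2 * ε ≤ R) (τ : ℝ) :
    deriv (fun τ => timeStep ε τ * (1 - timeStep R τ)) τ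
      = deriv (timeStep ε) τ - deriv (timeStep R) τ := by
  have hR0 : 0 < R := by linarith
  have h1 := ((contDiff_timeStep ε).differentiable (by simp) τ).hasDerivAt
  have h2 := ((contDiff_timeStep R).differentiable (by simp) τ).hasDerivAt
  have h3 : HasDerivAt (fun τ => timeStep ε τ * (1 - timeStep R τ)) _ τ :=
    h1.mul (h2.const_sub 1)
  rw [h3.deriv]
  rcases le_or_gt τ R with h | h
  · rw [timeStep_of_le hR0 h]
    rcases h.lt_or_eq with h' | rfl
    · rw [deriv_timeStep_of_lt hR0 h']; ring
    · rw [timeStep_of_ge hε hR]; ring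
  · rw [deriv_timeStep_of_gt hε (hR.trans_lt h), timeStep_of_ge hε (hR.trans h.le)]; ring

/-- The representation inequality is applied to a cutoff rising on [ε, 2ε] and falling on [R, 2R].
It bounds the difference of two shell averages, and the outer one vanishes as R → ∞. -/
theorem exists_lintegral_shell_le (d : ℕ) (hβ : 0 < β) :
    ∃ C : ℝ, 0 < C ∧ ∀ (T : ℝ) (f S₁ : Phase d → ℝ) (G S₀ : Phase d → Vel d) (p₁ p₂ p₃ : ℝ≥0∞),
      1 ≤ p₁ → 1 ≤ p₂ → 1 ≤ p₃ → (∀ᵐ z ∂(halfMeasure d T), 0 ≤ f z) →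
      MemLp f 2 (halfMeasure d T) → MemLp G p₁ (halfMeasure d T) →
      MemLp S₀ p₂ (halfMeasure d T) → MemLp S₁ p₃ (halfMeasure d T) →
      IsWeakVelGrad T f G → IsWeakSubsolution T f S₀ S₁ →
      ∀ z₀ ∈ halfSpace d T, ∀ ε, 0 < ε →
      ∫⁻ z, ‖f z‖ₑ * ENNReal.ofReal (shell β ε (relCoord z₀ z)) ∂(halfMeasure d T)
        ≤ ENNReal.ofReal C * kineticPotential β T G S₀ S₁ z₀ := by
  obtain ⟨C, hC, hmain⟩ := exists_ofReal_integral_deriv_cutoff_le d hβ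
  refine ⟨C, hC, ?_⟩
  intro T f S₁ G S₀ p₁ p₂ p₃ hp₁ hp₂ hp₃ hf0 hf hG hS₀ hS₁ hfG hsub z₀ hz₀ ε hε
  have hz : z₀.1 < T := hz₀
  have hint : ∀ δ, 0 < δ → Integrable (fun z => f z * shell β δ (relCoord z₀ z))
      (halfMeasure d T) := fun δ hδ =>
    hf.integrable_mul_of_hasCompactSupport one_le_two
      (isTestFunction_shell hβ hδ hz).smooth.continuous (isTestFunction_shell hβ hδ hz).compact
  have heq : ∀ δ, 0 < δ → ∫⁻ z, ‖f z‖ₑ * ENNReal.ofReal (shell β δ (relCoord z₀ z))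
      ∂(halfMeasure d T) = ENNReal.ofReal (∫ z, f z * shell β δ (relCoord z₀ z)
        ∂(halfMeasure d T)) := by
    intro δ hδ
    rw [ofReal_integral_eq_lintegral_ofReal (hint δ hδ)]
    · refine lintegral_congr_ae ?_
      filter_upwards [hf0] with z hz
      rw [ENNReal.ofReal_mul hz, ← Real.enorm_of_nonneg hz]
    · filter_upwards [hf0] with z hz
      exact mul_nonneg hz (shell_nonneg hδ _)
  have hR : ∀ R, 2 * ε ≤ R →
      ∫⁻ z, ‖f z‖ₑ * ENNReal.ofReal (shell β ε (relCoord z₀ z)) ∂(halfMeasure d T)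
        ≤ ENNReal.ofReal C * kineticPotential β T G S₀ S₁ z₀
          + ∫⁻ z, ‖f z‖ₑ * ENNReal.ofReal (shell β R (relCoord z₀ z)) ∂(halfMeasure d T) := by
    intro R hR
    have hR0 : 0 < R := by linarith
    have h01 : ∀ δ τ, 0 ≤ timeStep δ τ ∧ timeStep δ τ ≤ 1 := fun δ τ =>
      ⟨Real.smoothTransition.nonneg _, Real.smoothTransition.le_one _⟩
    have h1 := hmain T ε (2 * R) (fun τ => timeStep ε τ * (1 - timeStep R τ)) z₀
      ((contDiff_timeStep ε).mul (contDiff_const.sub (contDiff_timeStep R))) hε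
      (fun τ h => by rw [timeStep_of_le hε h.le, zero_mul])
      (fun τ h => by rw [timeStep_of_ge hR0 h.le, sub_self, mul_zero])
      (fun τ => mul_nonneg (h01 ε τ).1 (sub_nonneg.mpr (h01 R τ).2))
      (fun τ => mul_le_one₀ (h01 ε τ).2 (sub_nonneg.mpr (h01 R τ).2)
        (sub_le_self _ (h01 R τ).1)) hz f S₁ G S₀ 2 p₁ p₂ p₃ one_le_two hp₁ hp₂ hp₃ hf hG hS₀ hS₁
      hfG hsub
    rw [heq ε hε, heq R hR0]
    have h2 : ∫ z, f z * shell β ε (relCoord z₀ z) ∂(halfMeasure d T)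
        = ∫ z, f z * (deriv (fun τ => timeStep ε τ * (1 - timeStep R τ)) (relCoord z₀ z).1
          * density β (relCoord z₀ z)) ∂(halfMeasure d T)
          + ∫ z, f z * shell β R (relCoord z₀ z) ∂(halfMeasure d T) := by
      rw [← sub_eq_iff_eq_add, ← integral_sub (hint ε hε) (hint R hR0)]
      refine integral_congr_ae (ae_of_all _ fun z => ?_)
      simp only [deriv_timeStep_mul_one_sub hε hR, shell]
      ring
    rw [h2]
    exact ENNReal.ofReal_add_le.trans (by gcongr)
  have hlim := (tendsto_lintegral_shell_atTop hβ hf z₀).const_add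
    (ENNReal.ofReal C * kineticPotential β T G S₀ S₁ z₀)
  rw [add_zero] at hlim
  exact ge_of_tendsto hlim ((eventually_ge_atTop (2 * ε)).mono hR)

/-- Pointwise bound of a nonnegative weak subsolution by kinetic potentials. -/
theorem exists_enorm_le_kineticPotential (d : ℕ) (hβ : 0 < β) :
    ∃ C : ℝ, 0 < C ∧ ∀ (T : ℝ) (f S₁ : Phase d → ℝ) (G S₀ : Phase d → Vel d) (p₁ p₂ p₃ : ℝ≥0∞),
      1 ≤ p₁ → 1 ≤ p₂ → 1 ≤ p₃ → (∀ᵐ z ∂(halfMeasure d T), 0 ≤ f z) →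
      MemLp f 2 (halfMeasure d T) → MemLp G p₁ (halfMeasure d T) →
      MemLp S₀ p₂ (halfMeasure d T) → MemLp S₁ p₃ (halfMeasure d T) →
      IsWeakVelGrad T f G → IsWeakSubsolution T f S₀ S₁ →
      ∀ᵐ z₀ ∂(halfMeasure d T), ‖f z₀‖ₑ ≤ ENNReal.ofReal C * kineticPotential β T G S₀ S₁ z₀ := by
  obtain ⟨C, hC, hmain⟩ := exists_lintegral_shell_le d hβ
  have hM : 0 < (sliceMass d).toReal :=
    ENNReal.toReal_pos (sliceMass_ne_zero d) (sliceMass_ne_top d)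
  refine ⟨C / (sliceMass d).toReal, by positivity, ?_⟩
  intro T f S₁ G S₀ p₁ p₂ p₃ hp₁ hp₂ hp₃ hf0 hf hG hS₀ hS₁ hfG hsub
  have hs := hmain T f S₁ G S₀ p₁ p₂ p₃ hp₁ hp₂ hp₃ hf0 hf hG hS₀ hS₁ hfG hsub
  have hopen : MeasurableSet (halfSpace d T) := measurableSet_lt measurable_fst measurable_const
  set f' : Phase d → ℝ := hf.1.mk f with hf'
  have hf'm : Measurable f' := hf.1.stronglyMeasurable_mk.measurable
  have hff' : f =ᵐ[halfMeasure d T] f' := hf.1.ae_eq_mk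
  have hf'2 : MemLp f' 2 (halfMeasure d T) := hf.ae_eq hff'
  -- The approximate identity needs an integrable function, so f is truncated to balls. The shells
  -- being nonnegative, truncation only lowers the averages of |f|.
  have hg : ∀ n : ℕ, ∀ᵐ z₀, z₀ ∈ halfSpace d T → sliceMass d *
      ‖(halfSpace d T ∩ Metric.closedBall 0 (n : ℝ)).indicator f' z₀‖ₑ
        ≤ ENNReal.ofReal C * kineticPotential β T G S₀ S₁ z₀ := by
    intro n
    have hset : MeasurableSet (halfSpace d T ∩ Metric.closedBall 0 (n : ℝ)) :=
      hopen.inter measurableSet_closedBall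
    have hgm : Measurable ((halfSpace d T ∩ Metric.closedBall 0 (n : ℝ)).indicator f') :=
      hf'm.indicator hset
    refine sliceMass_mul_enorm_le_of_shell_le hβ hgm ?_ fun z₀ hz₀ ε hε => ?_
    · rw [integrable_indicator_iff hset, inter_comm, IntegrableOn,
        ← Measure.restrict_restrict measurableSet_closedBall]
      have : IsFiniteMeasure ((halfMeasure d T).restrict
          (Metric.closedBall 0 (n : ℝ))) :=
        ⟨by
          rw [Measure.restrict_apply_univ]
          exact (Measure.restrict_apply_le _ _).trans_lt measure_closedBall_lt_top⟩
      exact (hf'2.restrict _).integrable one_le_two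
    · have hsm : Measurable fun ζ : Phase d => ENNReal.ofReal (shell β ε ζ) :=
        (measurable_shell β ε).ennreal_ofReal
      have hF : Measurable fun ζ => ENNReal.ofReal (shell β ε ζ) *
          ‖(halfSpace d T ∩ Metric.closedBall 0 (n : ℝ)).indicator f' (galShift z₀ ζ)‖ₑ :=
        hsm.mul (hgm.comp (measurePreserving_galShift z₀).measurable).enorm
      rw [← lintegral_comp_relCoord z₀ hF]
      simp_rw [galShift_relCoord]
      refine le_trans ?_ (hs z₀ hz₀ ε hε)
      have e : ∫⁻ z, ‖f z‖ₑ * ENNReal.ofReal (shell β ε (relCoord z₀ z)) ∂(halfMeasure d T)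
          = ∫⁻ z, (halfSpace d T).indicator
            (fun z => ‖f' z‖ₑ * ENNReal.ofReal (shell β ε (relCoord z₀ z))) z := by
        rw [lintegral_indicator hopen]
        refine lintegral_congr_ae ?_
        filter_upwards [hff'] with z hz
        rw [hz]
      rw [e]
      refine lintegral_mono fun z => ?_
      by_cases hz : z ∈ halfSpace d T ∩ Metric.closedBall 0 (n : ℝ)
      · rw [indicator_of_mem hz, indicator_of_mem hz.1, mul_comm]
      · rw [indicator_of_notMem hz]; simp
  have hall := ae_all_iff.mpr hg
  have hae : ∀ᵐ z₀ ∂(halfMeasure d T), sliceMass d * ‖f z₀‖ₑ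
      ≤ ENNReal.ofReal C * kineticPotential β T G S₀ S₁ z₀ := by
    filter_upwards [ae_restrict_of_ae hall, ae_restrict_mem hopen, hff'] with z₀ h1 h2 h3
    obtain ⟨n, hn⟩ := exists_nat_ge ‖z₀‖
    have := h1 n h2
    rwa [indicator_of_mem (show z₀ ∈ halfSpace d T ∩ Metric.closedBall 0 (n : ℝ) from
      ⟨h2, mem_closedBall_zero_iff.mpr hn⟩), ← h3] at this
  filter_upwards [hae] with z₀ h
  rw [ENNReal.ofReal_div_of_pos hM, ENNReal.ofReal_toReal (sliceMass_ne_top d),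
    ENNReal.mul_comm_div, mul_div_assoc', ENNReal.le_div_iff_mul_le (Or.inl (sliceMass_ne_zero d))
      (Or.inl (sliceMass_ne_top d)), mul_comm]
  exact h

end PointwiseBound

/-! ### The embedding: choice of exponents and conclusion -/

/-- The potentials of measurable data are measurable. -/
theorem measurable_lintegral_kineticKernel {d : ℕ} {T : ℝ} (β L m : ℝ) {g : Phase d → ℝ≥0∞}
    (hg : AEMeasurable g (halfMeasure d T)) :
    Measurable fun z₀ => ∫⁻ z, kineticKernel β L m (z₀, z) * g z ∂(halfMeasure d T) := by
  have : SFinite (halfMeasure d T) := by unfold halfMeasure; infer_instance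
  have e : (fun z₀ => ∫⁻ z, kineticKernel β L m (z₀, z) * g z ∂(halfMeasure d T))
      = fun z₀ => ∫⁻ z, kineticKernel β L m (z₀, z) * hg.mk g z ∂(halfMeasure d T) := by
    funext z₀
    refine lintegral_congr_ae ?_
    filter_upwards [hg.ae_eq_mk] with z hz
    rw [hz]
  rw [e]
  have hm : Measurable fun z : Phase d × Phase d => kineticKernel β L m z * hg.mk g z.2 :=
    (measurable_kineticKernel β L m).mul (hg.measurable_mk.comp measurable_snd)
  exact hm.lintegral_prod_right'

theorem eLpNorm_ofReal_eq {α E : Type*} [MeasurableSpace α] [NormedAddCommGroup E] {μ : Measure α}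
    {p : ℝ} (hp : 0 < p) (f : α → E) :
    eLpNorm f (ENNReal.ofReal p) μ = (∫⁻ x, ‖f x‖ₑ ^ p ∂μ) ^ (1 / p) := by
  rw [eLpNorm_eq_lintegral_rpow_enorm_toReal (by simpa using hp) ENNReal.ofReal_ne_top,
    ENNReal.toReal_ofReal hp.le]

theorem theorem3p2 (d : ℕ) (hd : 1 ≤ d) (p q r : ℝ)
    (hp₁ : 2 - 2 / (3 * (d : ℝ) + 2) < p) (hp₂ : p < 2 + 2 / (d : ℝ))
    (hq : q = p * ((4 * (d : ℝ) + 2) / ((d : ℝ) * (p + 2))))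
    (hr : r = p * ((4 * (d : ℝ) + 2) / (p * (3 * (d : ℝ) + 2) - 2 * (d : ℝ)))) :
    ∃ C : ℝ, 0 < C ∧
      ∀ T : ℝ, 0 < T →
      ∀ (f : Phase d → ℝ) (G S₀ : Phase d → Vel d) (S₁ : Phase d → ℝ),
        (∀ᵐ z ∂(halfMeasure d T), 0 ≤ f z) →
        MemLp f 2 (halfMeasure d T) →
        IsWeakVelGrad T f G →
        MemLp G (ENNReal.ofReal p) (halfMeasure d T) →
        MemLp S₀ (ENNReal.ofReal (p / (p - 1))) (halfMeasure d T) →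
        MemLp S₁ (ENNReal.ofReal r) (halfMeasure d T) →
        IsWeakSubsolution T f S₀ S₁ →
        eLpNorm f (ENNReal.ofReal q) (halfMeasure d T) ≤
          ENNReal.ofReal C *
            (eLpNorm G (ENNReal.ofReal p) (halfMeasure d T)
              + eLpNorm S₀ (ENNReal.ofReal (p / (p - 1))) (halfMeasure d T)
              + eLpNorm S₁ (ENNReal.ofReal r) (halfMeasure d T)) := by
  have hd1 : (1 : ℝ) ≤ d := by exact_mod_cast hd
  have hd0 : (0 : ℝ) < d := by linarith
  have hp₁' : 2 + 6 * (d : ℝ) < p * (3 * d + 2) := by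
    have h : 2 / (3 * (d : ℝ) + 2) * (3 * d + 2) = 2 := by field_simp
    nlinarith
  have hp₂' : d * p < 2 * d + 2 := by
    have h : 2 / (d : ℝ) * d = 2 := by field_simp
    nlinarith
  have hp1 : 1 < p := by nlinarith
  have hp0 : 0 < p := by linarith
  -- the scaling exponent of the velocity relative to time
  have hden : 0 < p * (2 + 2 * d) - 4 * d := by nlinarith
  -- The difference of the scaling conditions for the gradient and for S₀, M (2 / p - 1) = 2β - 1
  -- with M = 1 + d (1 + 2β), is linear in β; this is its solution. Positivity is the upper bound on
  -- p, and β < 1 the lower bound.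
  obtain ⟨β, hβdef⟩ : ∃ β : ℝ, β = (2 * (1 + d) - d * p) / (p * (2 + 2 * d) - 4 * d) := ⟨_, rfl⟩
  have hβ : 0 < β := by rw [hβdef]; exact div_pos (by linarith) hden
  have hβD : β * (p * (2 + 2 * d) - 4 * d) = 2 * (1 + d) - d * p := by
    rw [hβdef, div_mul_cancel₀ _ hden.ne']
  have hβ1 : β < 1 := by rw [hβdef, div_lt_one hden]; linarith
  obtain ⟨M, hM⟩ : ∃ M : ℝ, M = 1 + d * (1 + 2 * β) := ⟨_, rfl⟩
  have hM0 : 0 < M := by rw [hM]; positivity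
  have hMD : M * (p * (2 + 2 * d) - 4 * d) = (4 * d + 2) * p := by
    rw [hM]; linear_combination 2 * d * hβD
  have hq0 : 0 < q := by rw [hq]; positivity
  have hrden : 0 < p * (3 * (d : ℝ) + 2) - 2 * d := by nlinarith
  have hr1 : 1 < r := by
    rw [hr, ← mul_div_assoc, one_lt_div hrden]; nlinarith
  have hp'1 : 1 < p / (p - 1) := by rw [one_lt_div (by linarith)]; linarith
  have hqinv : 1 / q = d * (p + 2) / (p * (4 * d + 2)) := by rw [hq]; field_simp
  have hrinv : 1 / r = (p * (3 * d + 2) - 2 * d) / (p * (4 * d + 2)) := by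
    rw [hr]; field_simp
  -- The three scaling conditions. Each positive right-hand side also gives the strict gap between
  -- source exponent and q that Hardy–Littlewood–Sobolev requires.
  have e1 : M * (1 / p - 1 / q) = β := by
    refine mul_right_cancel₀ hden.ne' ?_
    rw [mul_right_comm, hMD, hβD, hqinv]; field_simp; ring
  have e2 : M * (1 / (p / (p - 1)) - 1 / q) = 1 - β := by
    refine mul_right_cancel₀ hden.ne' ?_
    rw [mul_right_comm, hMD, sub_mul, hβD, hqinv, one_div_div]; field_simp; ring
  have e3 : M * (1 / r - 1 / q) = 1 := by
    refine mul_right_cancel₀ hden.ne' ?_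
    rw [mul_right_comm, hMD, hqinv, hrinv]; field_simp; ring
  have lt_of_mul : ∀ {s : ℝ}, 0 < s → 0 < M * (1 / s - 1 / q) → s < q := fun hs h =>
    (one_div_lt_one_div hq0 hs).mp (sub_pos.mp (pos_of_mul_pos_right h hM0.le))
  have hpq : p < q := lt_of_mul hp0 (by rw [e1]; exact hβ)
  have hp'q : p / (p - 1) < q := lt_of_mul (by linarith) (by rw [e2]; linarith)
  have hrq : r < q := lt_of_mul (by linarith) (by rw [e3]; exact one_pos)
  have hq1 : 1 ≤ q := hp1.le.trans hpq.le
  have hL : 0 ≤ 2 + β := by positivity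
  obtain ⟨C₀, hC₀, hpoint⟩ := exists_enorm_le_kineticPotential d hβ
  obtain ⟨C₁, hC₁, hb₁⟩ := exists_kineticKernel_bound (d := d) (m := d * (1 + 2 * β) + 1 - β)
    hβ hL hp1 hpq (by rw [← hM]; linear_combination e1 - hM)
  obtain ⟨C₂, hC₂, hb₂⟩ := exists_kineticKernel_bound (d := d) (m := d * (1 + 2 * β) + β)
    hβ hL hp'1 hp'q (by rw [← hM]; linear_combination e2 - hM)
  obtain ⟨C₃, hC₃, hb₃⟩ := exists_kineticKernel_bound (d := d) (m := d * (1 + 2 * β))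
    hβ hL hr1 hrq (by rw [← hM]; linear_combination e3 - hM)
  refine ⟨C₀ * (C₁ + C₂ + C₃), by positivity, ?_⟩
  intro T _ f G S₀ S₁ hf0 hf hfG hG hS₀ hS₁ hsub
  have hone : ∀ {s : ℝ}, 1 < s → 1 ≤ ENNReal.ofReal s := fun hs => by
    rw [ENNReal.one_le_ofReal]; exact hs.le
  have hpt := hpoint T f S₁ G S₀ _ _ _ (hone hp1) (hone hp'1) (hone hr1) hf0 hf hG hS₀ hS₁ hfG hsub
  rw [eLpNorm_ofReal_eq hq0, eLpNorm_ofReal_eq hp0, eLpNorm_ofReal_eq (by linarith : 0 < p / (p - 1)),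
    eLpNorm_ofReal_eq (by linarith : 0 < r)]
  have k₁ := hb₁ T (fun z => ‖G z‖ₑ) hG.1.enorm
  have k₂ := hb₂ T (fun z => ‖S₀ z‖ₑ) hS₀.1.enorm
  have k₃ := hb₃ T (fun z => ‖S₁ z‖ₑ) hS₁.1.enorm
  have m₁ := measurable_lintegral_kineticKernel β (2 + β) (d * (1 + 2 * β) + 1 - β) hG.1.enorm
  have m₂ := measurable_lintegral_kineticKernel β (2 + β) (d * (1 + 2 * β) + β) hS₀.1.enorm
  have m₃ := measurable_lintegral_kineticKernel β (2 + β) (d * (1 + 2 * β)) hS₁.1.enorm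
  have hpot : (∫⁻ z, kineticPotential β T G S₀ S₁ z ^ q ∂(halfMeasure d T)) ^ (1 / q)
      ≤ ENNReal.ofReal C₁ * (∫⁻ z, ‖G z‖ₑ ^ p ∂(halfMeasure d T)) ^ (1 / p)
        + ENNReal.ofReal C₂ * (∫⁻ z, ‖S₀ z‖ₑ ^ (p / (p - 1)) ∂(halfMeasure d T)) ^
          (1 / (p / (p - 1)))
        + ENNReal.ofReal C₃ * (∫⁻ z, ‖S₁ z‖ₑ ^ r ∂(halfMeasure d T)) ^ (1 / r) := by
    -- Minkowski's inequality in L^q separates the three potentials.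
    refine (ENNReal.lintegral_Lp_add_le (m₁.add m₂).aemeasurable m₃.aemeasurable hq1).trans ?_
    refine add_le_add ?_ k₃
    exact (ENNReal.lintegral_Lp_add_le m₁.aemeasurable m₂.aemeasurable hq1).trans
      (add_le_add k₁ k₂)
  have hmono : (∫⁻ z, ‖f z‖ₑ ^ q ∂(halfMeasure d T)) ^ (1 / q) ≤ ENNReal.ofReal C₀ *
      (∫⁻ z, kineticPotential β T G S₀ S₁ z ^ q ∂(halfMeasure d T)) ^ (1 / q) := by
    calc (∫⁻ z, ‖f z‖ₑ ^ q ∂(halfMeasure d T)) ^ (1 / q)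
        ≤ (∫⁻ z, (ENNReal.ofReal C₀ * kineticPotential β T G S₀ S₁ z) ^ q
            ∂(halfMeasure d T)) ^ (1 / q) := by
          refine ENNReal.rpow_le_rpow (lintegral_mono_ae ?_) (by positivity)
          filter_upwards [hpt] with z hz
          exact ENNReal.rpow_le_rpow hz hq0.le
      _ = _ := by
          simp_rw [ENNReal.mul_rpow_of_nonneg _ _ hq0.le]
          rw [lintegral_const_mul' _ _ (by simp [hq0.le]),
            ENNReal.mul_rpow_of_nonneg _ _ (by positivity), ← ENNReal.rpow_mul,
            mul_one_div_cancel hq0.ne', ENNReal.rpow_one]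
  refine (hmono.trans (mul_le_mul_right hpot _)).trans ?_
  rw [ENNReal.ofReal_mul hC₀.le, mul_assoc]
  gcongr
  rw [mul_add, mul_add]
  gcongr <;> linarith
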